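/- Let $N,M\ge 1$ and $a<q$. Let $\mathbf f\colon[a,q]\times\mathbb R^N\times\mathbb R^M\to\mathbb R^N$, $(t,\mathbf z,\bm\theta)\mapsto \mathbf f(t,\mathbf z,\bm\theta)$, be continuous and differentiable in $\mathbf z$ with continuous Jacobian $\nabla_{\mathbf z}\mathbf f$; let the running loss $\mathcal R\colon[a,q]\times\mathbb R^N\times\mathbb R^M\to\mathbb R$ be differentiable in $\mathbf z$ with continuous gradient $\nabla_{\mathbf z}\mathcal R$, and let the terminal loss $\mathcal T\colon\mathbb R^N\to\mathbb R$ be differentiable. For every $p\in[a,q]$ and $\mathbf x\in\mathbb R^N$ let there be given on $t\in[p,q]$: * a control $\bm\theta(t;p,\mathbf x)\in\mathbb R^M$, piecewise continuous in $t$; * a state $\mathbf z(t;p,\mathbf x)$, continuous in $t$, with $\mathbf z(p;p,\mathbf x)=\mathbf x$ and $\dot{\mathbf z}=\mathbf f(t,\mathbf z,\bm\theta)$ at every $t$ at which $\bm\theta(\cdot\,;p,\mathbf x)$ is continuous; * the Lagrange multiplier (adjoint state) $\bm\lambda(t;p,\mathbf x)\in\mathbb R^N$ of the Bolza functional $\int_p^q\mathcal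 R(t,\mathbf z,\bm\theta)\,dt+\mathcal T(\mathbf z(q))$ under the constraint $\dot{\mathbf z}=\mathbf f(t,\mathbf z,\bm\theta)$, that is, $\bm\lambda$ is continuous in $t$, $\bm\lambda(q;p,\mathbf x)=[\nabla_{\mathbf z}\mathcal T](\mathbf z(q;p,\mathbf x))$, and $$\int_p^q\Big(\big\langle\bm\lambda,[\nabla_{\mathbf z}\mathbf f](t,\mathbf z,\bm\theta)\,\bm\eta-\dot{\bm\eta}\big\rangle+\big\langle[\nabla_{\mathbf z}\mathcal R](t,\mathbf z,\bm\theta),\bm\eta\big\rangle\Big)dt+\big\langle[\nabla_{\mathbf z}\mathcal T](\mathbf z(q;p,\mathbf x)),\bm\eta(q)\big\rangle=0$$ for all continuously differentiable $\bm\eta\colon[p,q]\to\mathbb R^N$ with $\bm\eta(p)=0$. Suppose that the controls obey the invariant imbedding rule $\bm\theta(t;p,\mathbf x)=\bm\theta(t;s,\mathbf z(s;p,\mathbf x))$ for $a\le p\le s\le t\le q$ and all $\mathbf x$ (which is automatic if $\bm\theta=\bm\theta(t)$ does not depend on $(p,\mathbf x)$). Put $$\bm\Psi(p,\mathbf x)=\bm\theta(p;p,\mathbf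 x),\qquad\bm\Phi(p,\mathbf x)=\mathbf f(p,\mathbf x,\bm\Psi(p,\mathbf x)),\qquad\bm\Lambda(p,\mathbf x)=\bm\lambda(p;p,\mathbf x).$$ Then: 1. $\bm\Lambda(q,\mathbf x)=[\nabla_{\mathbf z}\mathcal T](\mathbf x)$ for all $\mathbf x$. 2. At every $(p,\mathbf x)\in[a,q]\times\mathbb R^N$ at which $\bm\Psi$ is continuous and $\bm\Lambda$ is differentiable (relative to $[a,q]\times\mathbb R^N$; the derivative in $p$ is one-sided at $p=a$ and $p=q$), $$-\nabla_p\bm\Lambda(p,\mathbf x)=\nabla_{\mathbf x}\bm\Lambda(p,\mathbf x)\cdot\bm\Phi(p,\mathbf x)+[\nabla_{\mathbf z}\mathbf f](p,\mathbf x,\bm\Psi(p,\mathbf x))^{\mathrm T}\bm\Lambda(p,\mathbf x)+[\nabla_{\mathbf z}\mathcal R](p,\mathbf x,\bm\Psi(p,\mathbf x)).$$ 3. Suppose that $\nabla_{\mathbf z}\mathcal T$ is continuously differentiable, and that $\bm\Phi(p,\mathbf x)$, $[\nabla_{\mathbf z}\mathbf f](p,\mathbf x,\bm\Psi(p,\mathbf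 x))$ and $[\nabla_{\mathbf z}\mathcal R](p,\mathbf x,\bm\Psi(p,\mathbf x))$ are differentiable in $\mathbf x$, they and their $\mathbf x$-derivatives being continuous on $[a,q]\times\mathbb R^N$ except for finitely many values of $p$, where they have limits from both sides in $p$, jointly in $(p,\mathbf x)$. Then $\bm\Lambda$ is differentiable at every $(p,\mathbf x)$ at which $\bm\Psi$ is continuous, so that the equation in 2 holds there. -/

import Mathlib

open Set Filter Topology
open scoped InnerProductSpace

namespace InvariantImbedding

noncomputable section

/-- A function of time is piecewise continuous on `[a, b]`: it has finitely many discontinuities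
there, and one-sided limits (inside `[a, b]`) at every point. Its values at the discontinuities are
unrestricted. -/
def PiecewiseContinuousOn {Y : Type*} [TopologicalSpace Y] (g : ℝ → Y) (a b : ℝ) : Prop :=
  {t | t ∈ Icc a b ∧ ¬ ContinuousWithinAt g (Icc a b) t}.Finite ∧
  ∀ t ∈ Icc a b,
    (∃ l, Tendsto g (𝓝[Icc a b ∩ Ioi t] t) (𝓝 l)) ∧
    (∃ l, Tendsto g (𝓝[Icc a b ∩ Iio t] t) (𝓝 l))

/-- A function `g t x` of time and state is continuous on `[a, b] × X`, except for finitely many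
times at which it may jump, having limits from both sides in time there, jointly in `(t, x)`. -/
def PiecewiseContinuousInTimeOn {X Y : Type*} [TopologicalSpace X] [TopologicalSpace Y]
    (g : ℝ → X → Y) (a b : ℝ) : Prop :=
  {t | t ∈ Icc a b ∧
    ∃ x, ¬ ContinuousWithinAt (Function.uncurry g) (Icc a b ×ˢ univ) (t, x)}.Finite ∧
  ∀ t ∈ Icc a b, ∀ x,
    (∃ l, Tendsto (Function.uncurry g) (𝓝[(Icc a b ∩ Ioi t) ×ˢ univ] (t, x)) (𝓝 l)) ∧
    (∃ l, Tendsto (Function.uncurry g) (𝓝[(Icc a b ∩ Iio t) ×ˢ univ] (t, x)) (𝓝 l))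

/-- `g t x` has a derivative in `x`, and `g` and that derivative are piecewise continuous in
time, jointly in `(t, x)`. -/
def C1InState {X Y : Type*} [NormedAddCommGroup X] [NormedSpace ℝ X]
    [NormedAddCommGroup Y] [NormedSpace ℝ Y] (g : ℝ → X → Y) (a b : ℝ) : Prop :=
  (∀ t ∈ Icc a b, Differentiable ℝ (g t)) ∧
  PiecewiseContinuousInTimeOn g a b ∧
  PiecewiseContinuousInTimeOn (fun t x => fderiv ℝ (g t) x) a b

/-- `z` solves `ż(t) = f (t, z(t), θ(t))` on `[p, q]` with `z(p) = x`. For a piecewise continuous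
control `θ` the trajectory is continuous, and the equation holds wherever `θ` is continuous
(with one-sided derivatives at `p` and `q`). -/
structure IsTrajectory {E P : Type*} [NormedAddCommGroup E] [NormedSpace ℝ E] [TopologicalSpace P]
    (f : ℝ → E → P → E) (θ : ℝ → P) (z : ℝ → E) (p q : ℝ) (x : E) : Prop where
  continuousOn : ContinuousOn z (Icc p q)
  initial : z p = x
  deriv_eq : ∀ t ∈ Icc p q, ContinuousWithinAt θ (Icc p q) t →
    HasDerivWithinAt z (f t (z t) (θ t)) (Icc p q) t

/-- The Jacobian `[∇_z f](t, z, θ)`. -/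
def zJac {E P : Type*} [NormedAddCommGroup E] [NormedSpace ℝ E]
    (f : ℝ → E → P → E) (t : ℝ) (z : E) (θ : P) : E →L[ℝ] E :=
  fderiv ℝ (fun y => f t y θ) z

/-- The gradient `[∇_z R](t, z, θ)`. -/
def zGrad {E P : Type*} [NormedAddCommGroup E] [InnerProductSpace ℝ E] [CompleteSpace E]
    (R : ℝ → E → P → ℝ) (t : ℝ) (z : E) (θ : P) : E :=
  gradient (fun y => R t y θ) z

/-- `lam` is the Lagrange multiplier (adjoint state), along the control `θ` and the trajectory `z`
on `[p, q]`, of the Bolza functional `∫ R(t, z, θ) dt + T(z(q))` under the constraint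
`ż = f(t, z, θ)`: its value at `q` is the gradient of the terminal loss, and the first variation of
the Lagrangian `∫ R(t, z, θ) dt + T(z(q)) + ∫ ⟪lam, f(t, z, θ) - ż⟫ dt` vanishes for all
continuously differentiable variations `η` of the state with `η(p) = 0`. -/
structure IsLagrangeMultiplier {E P : Type*} [NormedAddCommGroup E] [InnerProductSpace ℝ E]
    [CompleteSpace E] (f : ℝ → E → P → E) (R : ℝ → E → P → ℝ) (T : E → ℝ)
    (θ : ℝ → P) (z lam : ℝ → E) (p q : ℝ) : Prop where
  continuousOn : ContinuousOn lam (Icc p q)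
  terminal : lam q = gradient T (z q)
  stationary : ∀ η dη : ℝ → E, ContinuousOn dη (Icc p q) →
    (∀ t ∈ Icc p q, HasDerivWithinAt η (dη t) (Icc p q) t) → η p = 0 →
    (∫ t in p..q, (⟪lam t, zJac f t (z t) (θ t) (η t) - dη t⟫_ℝ
        + ⟪zGrad R t (z t) (θ t), η t⟫_ℝ))
      + ⟪gradient T (z q), η q⟫_ℝ = 0

/-- For a family `u(t; p, x)`, its value `u(p; p, x)` at the input position. For the control this
is `Ψ(p, x) = θ(p; p, x)`, for the multiplier the imbedded adjoint `Λ(p, x) = λ(p; p, x)`. -/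
def imbed {E Y : Type*} (u : ℝ → ℝ → E → Y) (p : ℝ) (x : E) : Y := u p p x

/-- `Φ(p, x) = f(p, x, Ψ(p, x))`. -/
def imbedDyn {E P : Type*} (f : ℝ → E → P → E) (θ : ℝ → ℝ → E → P) (p : ℝ) (x : E) : E :=
  f p x (imbed θ p x)

end

end InvariantImbedding

/-!
Along every trajectory the control is in feedback form, `θ(t; p, x) = Ψ(t, z(t; p, x))`, by the
invariant imbedding rule. Testing stationarity with the variation `η' = κ - lam`, where `κ` is the
primitive that the adjoint equation prescribes, shows that `lam` solves the adjoint equation in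
integral form (`eq_add_integral_of_stationary`). By uniqueness for this equation and for the state
equation, `lam(t; p, x) = Λ(t, z(t; p, x))`. This is collected in `IsAdjointFlow`, established in
`isAdjointFlow_of_imbedding`, on which everything else rests.

The differential equation for `Λ` is then the derivative of `t ↦ Λ(t, z(t; p, x))`
(`IsAdjointFlow.fderivWithin_apply`). At `t = q` no trajectory leads into the domain, so increments
are taken along short trajectories that end at time `q`; the first-order asymptotics of states and
multipliers are uniform over short trajectories (`IsAdjointFlow.state_drift`,
`IsAdjointFlow.multiplier_drift`).

For the differentiability of `Λ`, a linear integral equation whose data are differentiable in a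
parameter has solutions differentiable in it (`exists_hasFDerivAt_of_eq_add_integral`): the
candidate derivative solves a linear Volterra equation, and Grönwall's inequality with dominated
convergence bounds the remainder. Applied forwards to the states and backwards to the multipliers,
this makes `Λ(p, ·)` differentiable for each fixed `p` (`IsAdjointFlow.differentiableAt_adjoint`).
Joint differentiability at `(p₀, x₀)` needs no more than differentiability of `Λ(p₀, ·)`: every
nearby `(p, y)` lies on a short trajectory through some `(p₀, x)`
(`IsAdjointFlow.exists_connecting`), which is immediate for `p ≤ p₀` and a contraction argument for
`p ≥ p₀`, and along it `Λ` changes to first order by the adjoint equation.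
-/

open MeasureTheory InvariantImbedding

/-! ### Integral equations with finitely many exceptional times -/

/-- `g` is bounded on `[p, q]` and continuous there, both only away from the exceptional set `S`
(always finite in the applications). The values of `g` on `S` are irrelevant, since such
functions enter through their integrals only. -/
structure BddContOff {Y : Type*} [NormedAddCommGroup Y] (S : Set ℝ) (g : ℝ → Y) (p q : ℝ) :
    Prop where
  continuousOn : ContinuousOn g (Icc p q \ S)
  bound : ∃ C, ∀ t ∈ Icc p q \ S, ‖g t‖ ≤ C

section BddContOff

variable {X Y : Type*} [NormedAddCommGroup X] [NormedAddCommGroup Y] {S : Set ℝ} {p q : ℝ}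

lemma BddContOff.mono {g : ℝ → Y} (hg : BddContOff S g p q) {S' : Set ℝ} {p' q' : ℝ}
    (hS : S ⊆ S') (hp : p ≤ p') (hq : q' ≤ q) : BddContOff S' g p' q' := by
  have h : Icc p' q' \ S' ⊆ Icc p q \ S :=
    fun t ht => ⟨⟨hp.trans ht.1.1, ht.1.2.trans hq⟩, fun h => ht.2 (hS h)⟩
  obtain ⟨C, hC⟩ := hg.bound
  exact ⟨hg.continuousOn.mono h, C, fun t ht => hC t (h ht)⟩

lemma ContinuousOn.bddContOff {g : ℝ → Y} (hg : ContinuousOn g (Icc p q)) (S : Set ℝ) :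
    BddContOff S g p q := by
  obtain ⟨C, hC⟩ := isCompact_Icc.exists_bound_of_continuousOn hg
  exact ⟨hg.mono sdiff_subset, C, fun t ht => hC t ht.1⟩

lemma ae_of_forall_notMem (hS : S.Finite) {P : ℝ → Prop} {s : Set ℝ}
    (h : ∀ t ∈ s \ S, P t) : ∀ᵐ t : ℝ, t ∈ s → P t := by
  have h0 : ∀ᵐ t : ℝ, t ∉ S := measure_eq_zero_iff_ae_notMem.1 (hS.countable.measure_zero volume)
  filter_upwards [h0] with t ht hts
  exact h t ⟨hts, ht⟩

lemma BddContOff.intervalIntegrable {g : ℝ → Y} (hg : BddContOff S g p q) (hS : S.Finite)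
    (hpq : p ≤ q) : IntervalIntegrable g volume p q := by
  rw [intervalIntegrable_iff_integrableOn_Icc_of_le hpq]
  have hae : (Icc p q \ S : Set ℝ) =ᵐ[volume] Icc p q :=
    sdiff_null_ae_eq_self (hS.countable.measure_zero volume)
  rw [← integrableOn_congr_set_ae hae]
  have hmeas : MeasurableSet (Icc p q \ S) := measurableSet_Icc.diff hS.measurableSet
  obtain ⟨C, hC⟩ := hg.bound
  have : IsFiniteMeasure (volume.restrict (Icc p q \ S)) :=
    ⟨by
      rw [Measure.restrict_apply_univ]
      exact (measure_mono sdiff_subset).trans_lt measure_Icc_lt_top⟩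
  refine Integrable.of_bound (hg.continuousOn.aestronglyMeasurable hmeas) C ?_
  exact (ae_restrict_iff' hmeas).2 (Eventually.of_forall hC)

lemma BddContOff.add {g h : ℝ → Y} (hg : BddContOff S g p q) (hh : BddContOff S h p q) :
    BddContOff S (fun t => g t + h t) p q := by
  obtain ⟨C, hC⟩ := hg.bound
  obtain ⟨D, hD⟩ := hh.bound
  exact ⟨hg.continuousOn.add hh.continuousOn, C + D,
    fun t ht => (norm_add_le _ _).trans (add_le_add (hC t ht) (hD t ht))⟩

lemma BddContOff.neg {g : ℝ → Y} (hg : BddContOff S g p q) :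
    BddContOff S (fun t => -g t) p q := by
  obtain ⟨C, hC⟩ := hg.bound
  exact ⟨hg.continuousOn.neg, C, fun t ht => by simpa using hC t ht⟩

lemma BddContOff.sub {g h : ℝ → Y} (hg : BddContOff S g p q) (hh : BddContOff S h p q) :
    BddContOff S (fun t => g t - h t) p q := by
  simpa [sub_eq_add_neg] using hg.add hh.neg

lemma BddContOff.norm {g : ℝ → Y} (hg : BddContOff S g p q) :
    BddContOff S (fun t => ‖g t‖) p q := by
  obtain ⟨C, hC⟩ := hg.bound
  exact ⟨hg.continuousOn.norm, C, fun t ht => by simpa using hC t ht⟩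

lemma BddContOff.clm_apply [NormedSpace ℝ X] [NormedSpace ℝ Y] {A : ℝ → X →L[ℝ] Y}
    {g : ℝ → X} (hA : BddContOff S A p q)
    (hg : BddContOff S g p q) : BddContOff S (fun t => A t (g t)) p q := by
  obtain ⟨C, hC⟩ := hA.bound
  obtain ⟨D, hD⟩ := hg.bound
  refine ⟨hA.continuousOn.clm_apply hg.continuousOn, C * D, fun t ht => ?_⟩
  exact (A t).le_of_opNorm_le_of_le (hC t ht) (hD t ht)

lemma BddContOff.clm_const [NormedSpace ℝ X] [NormedSpace ℝ Y] {g : ℝ → X} (L : X →L[ℝ] Y)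
    (hg : BddContOff S g p q) :
    BddContOff S (fun t => L (g t)) p q :=
  (continuousOn_const.bddContOff S : BddContOff S (fun _ => L) p q).clm_apply hg

/-- Reversal of time. -/
lemma BddContOff.reverse {g : ℝ → Y} (hg : BddContOff S g p q) :
    BddContOff ((fun t => p + q - t) ⁻¹' S) (fun t => g (p + q - t)) p q := by
  have h : ∀ t ∈ Icc p q \ (fun t => p + q - t) ⁻¹' S, p + q - t ∈ Icc p q \ S :=
    fun t ht => ⟨⟨by linarith [ht.1.2], by linarith [ht.1.1]⟩, ht.2⟩
  obtain ⟨C, hC⟩ := hg.bound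
  exact ⟨hg.continuousOn.comp (by fun_prop) h, C, fun t ht => hC _ (h t ht)⟩

lemma finite_reverse (hS : S.Finite) (c : ℝ) : ((fun t => c - t) ⁻¹' S).Finite :=
  hS.preimage (sub_right_injective.injOn)

lemma continuousOn_reverse {g : ℝ → Y} (hg : ContinuousOn g (Icc p q)) :
    ContinuousOn (fun t => g (p + q - t)) (Icc p q) :=
  hg.comp (by fun_prop) fun t ht => ⟨by linarith [ht.2], by linarith [ht.1]⟩

lemma intervalIntegral_reverse [NormedSpace ℝ Y] (g : ℝ → Y) (p q t : ℝ) :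
    ∫ s in p..t, g (p + q - s) = ∫ s in (p + q - t)..q, g s := by
  rw [intervalIntegral.integral_comp_sub_left]
  simp

lemma IntervalIntegrable.sub_Icc {g : ℝ → Y} (hg : IntervalIntegrable g volume p q)
    {s t : ℝ} (hs : s ∈ Icc p q) (ht : t ∈ Icc p q) : IntervalIntegrable g volume s t := by
  refine hg.mono_set ?_
  rw [uIcc_of_le (hs.1.trans hs.2)]
  exact uIcc_subset_Icc hs ht

end BddContOff

/-! ### Grönwall estimates and linear Volterra equations -/

section Gronwall

variable {X : Type*} [NormedAddCommGroup X] [NormedSpace ℝ X] {S : Set ℝ} {p q : ℝ}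

lemma le_mul_exp_of_le_integral {u : ℝ → ℝ} {c K : ℝ} (hpq : p ≤ q) (hc : 0 ≤ c) (hK : 0 ≤ K)
    (hu : ContinuousOn u (Icc p q)) (hu0 : ∀ t, 0 ≤ u t)
    (h : ∀ t ∈ Icc p q, u t ≤ c + K * ∫ s in p..t, u s) :
    ∀ t ∈ Icc p q, u t ≤ c * Real.exp (K * (t - p)) := by
  set v : ℝ → ℝ := IccExtend hpq ((Icc p q).domRestrict u) with hv
  have hvc : Continuous v := (continuousOn_iff_continuous_domRestrict.1 hu).Icc_extend'
  have hvu : ∀ t ∈ Icc p q, v t = u t := fun t ht => by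
    simp [hv, IccExtend_of_mem _ _ ht, domRestrict_apply]
  have hv0 : ∀ t, 0 ≤ v t := fun t => hu0 _
  have hint : ∀ t ∈ Icc p q, ∫ s in p..t, u s = ∫ s in p..t, v s := by
    intro t ht
    refine intervalIntegral.integral_congr fun s hs => ?_
    rw [uIcc_of_le ht.1] at hs
    exact (hvu s ⟨hs.1, hs.2.trans ht.2⟩).symm
  set W : ℝ → ℝ := fun t => c + K * ∫ s in p..t, v s with hW
  have hWd : ∀ t, HasDerivAt W (K * v t) t := fun t =>
    ((hvc.integral_hasStrictDerivAt p t).hasDerivAt.const_mul K).const_add c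
  have hWv : ∀ t ∈ Icc p q, v t ≤ W t := fun t ht => by
    have := h t ht
    rwa [hint t ht, ← hvu t ht] at this
  have key := norm_le_gronwallBound_of_norm_deriv_right_le (f := W) (f' := fun t => K * v t)
    (δ := c) (K := K) (ε := 0) (a := p) (b := q)
    (fun t _ => (hWd t).continuousAt.continuousWithinAt)
    (fun t _ => (hWd t).hasDerivWithinAt) (by simp [hW, abs_of_nonneg hc])
    (fun t ht => by
      have h1 := hWv t ⟨ht.1, ht.2.le⟩
      rw [add_zero, Real.norm_of_nonneg (mul_nonneg hK (hv0 t)),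
        Real.norm_of_nonneg ((hv0 t).trans h1)]
      exact mul_le_mul_of_nonneg_left h1 hK)
  intro t ht
  have h2 := key t ht
  rw [gronwallBound_ε0] at h2
  rw [← hvu t ht]
  exact (hWv t ht).trans ((le_abs_self _).trans h2)

/-- Grönwall's inequality for `u(t) = u₀ + ∫ k` with `‖k‖ ≤ K ‖u‖ + ρ`. -/
lemma norm_le_of_eq_add_integral (hS : S.Finite) {u k : ℝ → X} {ρ : ℝ → ℝ} {u₀ : X} {K : ℝ}
    (hpq : p ≤ q) (hK : 0 ≤ K) (hu : ContinuousOn u (Icc p q))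
    (hρ : IntervalIntegrable ρ volume p q) (hρ0 : ∀ t, 0 ≤ ρ t)
    (heq : ∀ t ∈ Icc p q, u t = u₀ + ∫ s in p..t, k s)
    (hk : ∀ s ∈ Icc p q \ S, ‖k s‖ ≤ K * ‖u s‖ + ρ s) :
    ∀ t ∈ Icc p q, ‖u t‖ ≤ (‖u₀‖ + ∫ s in p..q, ρ s) * Real.exp (K * (q - p)) := by
  have hun : IntervalIntegrable (fun s => ‖u s‖) volume p q := by
    refine ContinuousOn.intervalIntegrable ?_
    rw [uIcc_of_le hpq]
    exact hu.norm
  have hρi : 0 ≤ ∫ s in p..q, ρ s := intervalIntegral.integral_nonneg hpq fun t _ => hρ0 t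
  have main := le_mul_exp_of_le_integral (u := fun t => ‖u t‖) (c := ‖u₀‖ + ∫ s in p..q, ρ s)
    (K := K) hpq (by positivity) hK hu.norm (fun t => norm_nonneg _) ?_
  · intro t ht
    refine (main t ht).trans (mul_le_mul_of_nonneg_left ?_ (by positivity))
    exact Real.exp_le_exp.2 (mul_le_mul_of_nonneg_left (by linarith [ht.2]) hK)
  · intro t ht
    have hp : p ∈ Icc p q := ⟨le_rfl, hpq⟩
    have hun' := hun.sub_Icc hp ht
    have hρ' := hρ.sub_Icc hp ht
    have h1 : ‖∫ s in p..t, k s‖ ≤ ∫ s in p..t, (K * ‖u s‖ + ρ s) := by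
      refine intervalIntegral.norm_integral_le_of_norm_le ht.1 ?_ ((hun'.const_mul K).add hρ')
      refine ae_of_forall_notMem hS fun s hs => hk s ⟨⟨hs.1.1.le, hs.1.2.trans ht.2⟩, hs.2⟩
    rw [intervalIntegral.integral_add (hun'.const_mul K) hρ',
      intervalIntegral.integral_const_mul] at h1
    have h2 : ∫ s in p..t, ρ s ≤ ∫ s in p..q, ρ s := by
      rw [← intervalIntegral.integral_add_adjacent_intervals hρ'
        (hρ.sub_Icc ht ⟨hpq, le_rfl⟩)]
      linarith [intervalIntegral.integral_nonneg (f := ρ) (μ := volume) ht.2 fun t _ => hρ0 t]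
    calc ‖u t‖ ≤ ‖u₀‖ + ‖∫ s in p..t, k s‖ := by rw [heq t ht]; exact norm_add_le _ _
      _ ≤ _ := by linarith

/-- Grönwall's inequality backwards in time. -/
lemma norm_le_of_eq_add_integral_right (hS : S.Finite) {u k : ℝ → X} {ρ : ℝ → ℝ} {u₀ : X}
    {K : ℝ} (hpq : p ≤ q) (hK : 0 ≤ K) (hu : ContinuousOn u (Icc p q))
    (hρ : IntervalIntegrable ρ volume p q) (hρ0 : ∀ t, 0 ≤ ρ t)
    (heq : ∀ t ∈ Icc p q, u t = u₀ + ∫ s in t..q, k s)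
    (hk : ∀ s ∈ Icc p q \ S, ‖k s‖ ≤ K * ‖u s‖ + ρ s) :
    ∀ t ∈ Icc p q, ‖u t‖ ≤ (‖u₀‖ + ∫ s in p..q, ρ s) * Real.exp (K * (q - p)) := by
  have hmem : ∀ t ∈ Icc p q, p + q - t ∈ Icc p q :=
    fun t ht => ⟨by linarith [ht.2], by linarith [ht.1]⟩
  have main := norm_le_of_eq_add_integral (finite_reverse hS (p + q))
    (u := fun t => u (p + q - t)) (k := fun t => k (p + q - t)) (ρ := fun t => ρ (p + q - t))
    (u₀ := u₀) hpq hK (continuousOn_reverse hu)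
    (by simpa using (hρ.comp_sub_left (p + q)).symm) (fun t => hρ0 _)
    (fun t ht => by rw [heq _ (hmem t ht), intervalIntegral_reverse])
    (fun s hs => hk _ ⟨hmem s hs.1, hs.2⟩)
  intro t ht
  have := main _ (hmem t ht)
  rw [intervalIntegral_reverse] at this
  simpa using this

/-- A continuous function that stays below `c < 1` as long as it was at most `1` before stays
below `c` throughout. -/
lemma le_of_forall_le_one_imp {u : ℝ → ℝ} {c : ℝ} (hc : c < 1) (hu : ContinuousOn u (Icc p q))
    (h : ∀ t ∈ Icc p q, (∀ s ∈ Ico p t, u s ≤ 1) → u t ≤ c) : ∀ t ∈ Icc p q, u t ≤ c := by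
  have hlt : ∀ t ∈ Icc p q, u t < 1 := by
    by_contra! hcon
    obtain ⟨t₁, ht₁, hut₁⟩ := hcon
    have hcomp : IsCompact (Icc p q ∩ u ⁻¹' Ici 1) :=
      isCompact_Icc.of_isClosed_subset (hu.preimage_isClosed_of_isClosed isClosed_Icc isClosed_Ici)
        inter_subset_left
    -- the first time at which `u` reaches `1`
    obtain ⟨t, ht, hmin⟩ := hcomp.exists_isLeast ⟨t₁, ht₁, hut₁⟩
    have := h t ht.1 fun s hs => by
      by_contra! hs1
      exact absurd (hmin ⟨⟨hs.1, hs.2.le.trans ht.1.2⟩, hs1.le⟩) (not_le.2 hs.2)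
    have h1 : (1 : ℝ) ≤ u t := ht.2
    linarith
  exact fun t ht => h t ht fun s hs => (hlt s ⟨hs.1, hs.2.le.trans ht.2⟩).le

end Gronwall

section Volterra

variable {X : Type*} [NormedAddCommGroup X] [NormedSpace ℝ X] [CompleteSpace X] {S : Set ℝ}
  {p q : ℝ}

/-- Existence for linear Volterra equations, by the Neumann series. -/
lemma exists_eq_add_integral_clm (hS : S.Finite) (hpq : p ≤ q) {A : ℝ → X →L[ℝ] X}
    (hA : BddContOff S A p q) {b : ℝ → X} (hb : ContinuousOn b (Icc p q)) :
    ∃ u : ℝ → X, ContinuousOn u (Icc p q) ∧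
      ∀ t ∈ Icc p q, u t = b t + ∫ s in p..t, A s (u s) := by
  obtain ⟨M, hM⟩ := hA.bound
  obtain ⟨B, hB⟩ := isCompact_Icc.exists_bound_of_continuousOn hb
  have hB0 : 0 ≤ B := (norm_nonneg _).trans (hB p ⟨le_rfl, hpq⟩)
  wlog hM0 : 0 ≤ M generalizing M
  · exact this (max M 0) (fun t ht => (hM t ht).trans (le_max_left _ _)) (le_max_right _ _)
  let v : ℕ → ℝ → X := fun n => Nat.rec b (fun _ w t => ∫ s in p..t, A s (w s)) n
  have hv0 : v 0 = b := rfl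
  have hvs : ∀ n t, v (n + 1) t = ∫ s in p..t, A s (v n s) := fun _ _ => rfl
  have hvc : ∀ n, ContinuousOn (v n) (Icc p q) := by
    intro n
    induction n with
    | zero => exact hb
    | succ n ih =>
      have := (hA.clm_apply (ih.bddContOff S)).intervalIntegrable hS hpq
      have h2 := intervalIntegral.continuousOn_primitive_interval' this
        (by rw [uIcc_of_le hpq]; exact ⟨le_rfl, hpq⟩ : p ∈ uIcc p q)
      rw [uIcc_of_le hpq] at h2
      exact h2
  have hAv : ∀ n, BddContOff S (fun s => A s (v n s)) p q :=
    fun n => hA.clm_apply ((hvc n).bddContOff S)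
  have hvb : ∀ n, ∀ t ∈ Icc p q, ‖v n t‖ ≤ B * ((M * (t - p)) ^ n / n.factorial) := by
    intro n
    induction n with
    | zero => intro t ht; simpa [hv0] using hB t ht
    | succ n ih =>
      intro t ht
      rw [hvs]
      have h1 : ‖∫ s in p..t, A s (v n s)‖
          ≤ ∫ s in p..t, M * (B * ((M * (s - p)) ^ n / n.factorial)) := by
        refine intervalIntegral.norm_integral_le_of_norm_le ht.1 ?_
          (Continuous.intervalIntegrable (by fun_prop) _ _)
        refine ae_of_forall_notMem hS fun s hs => ?_
        have hs' : s ∈ Icc p q := ⟨hs.1.1.le, hs.1.2.trans ht.2⟩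
        exact (A s).le_of_opNorm_le_of_le (hM s ⟨hs', hs.2⟩) (ih s hs')
      refine h1.trans (le_of_eq ?_)
      have h2 : ∀ s, M * (B * ((M * (s - p)) ^ n / n.factorial))
          = (B * M ^ (n + 1) / n.factorial) * (s - p) ^ n := fun s => by
        rw [mul_pow]; ring
      simp only [h2]
      rw [intervalIntegral.integral_const_mul,
        intervalIntegral.integral_comp_sub_right (fun x => x ^ n) p, integral_pow]
      rw [mul_pow, Nat.factorial_succ]
      have : (n.factorial : ℝ) ≠ 0 := by positivity
      push_cast
      field_simp
      simp
  have hsum : Summable fun n : ℕ => B * ((M * (q - p)) ^ n / n.factorial) :=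
    (Real.summable_pow_div_factorial _).mul_left B
  have hvb' : ∀ n, ∀ t ∈ Icc p q, ‖v n t‖ ≤ B * ((M * (q - p)) ^ n / n.factorial) := by
    intro n t ht
    refine (hvb n t ht).trans ?_
    have : 0 ≤ t - p := by linarith [ht.1]
    gcongr
    exact ht.2
  have hsv : ∀ t ∈ Icc p q, Summable fun n => v n t := fun t ht =>
    Summable.of_norm_bounded hsum fun n => hvb' n t ht
  refine ⟨fun t => ∑' n, v n t, continuousOn_tsum hvc hsum fun n t ht => hvb' n t ht, ?_⟩
  intro t ht
  have hI : HasSum (fun n => ∫ s in p..t, A s (v n s)) (∫ s in p..t, A s (∑' n, v n s)) := by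
    refine intervalIntegral.hasSum_integral_of_dominated_convergence
      (fun n _ => M * (B * ((M * (q - p)) ^ n / n.factorial))) ?_ ?_ ?_ ?_ ?_
    · intro n
      exact (((hAv n).intervalIntegrable hS hpq).sub_Icc ⟨le_rfl, hpq⟩
        ht).def'.aestronglyMeasurable
    · intro n
      refine ae_of_forall_notMem hS fun s hs => ?_
      rw [uIoc_of_le ht.1] at hs
      have hs' : s ∈ Icc p q := ⟨hs.1.1.le, hs.1.2.trans ht.2⟩
      exact (A s).le_of_opNorm_le_of_le (hM s ⟨hs', hs.2⟩) (hvb' n s hs')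
    · exact Eventually.of_forall fun s _ => hsum.mul_left M
    · exact intervalIntegrable_const
    · refine Eventually.of_forall fun s hs => ?_
      rw [uIoc_of_le ht.1] at hs
      have hs' : s ∈ Icc p q := ⟨hs.1.le, hs.2.trans ht.2⟩
      exact (hsv s hs').hasSum.mapL (A s)
  have h1 := (hsv t ht).tsum_eq_zero_add
  simp only [hvs, hI.tsum_eq] at h1
  exact h1

end Volterra

/-! ### Differentiable dependence on parameters -/

section Parameter

variable {E X : Type*} [NormedAddCommGroup E] [NormedSpace ℝ E] [NormedAddCommGroup X]
  [NormedSpace ℝ X] [CompleteSpace X] {S : Set ℝ} {p q : ℝ}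

/-- If the increments `y(t, x) - y(t, x₀)` solve a linear integral equation whose data are
differentiable in `x` at `x₀` for each fixed time, then so are the solutions. The derivative solves
the linearized equation; the error is controlled by Grönwall's inequality and dominated
convergence, so no uniformity in time of the differentiability is needed. -/
lemma exists_hasFDerivAt_of_eq_add_integral (hS : S.Finite) (hpq : p ≤ q) {y : ℝ → E → X}
    {x₀ : E} {A : ℝ → X →L[ℝ] X} {m : ℝ → E → X} {m' : ℝ → E →L[ℝ] X} {b : E → X}
    {b' : E →L[ℝ] X} (hA : BddContOff S A p q) (hm' : BddContOff S m' p q)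
    (hb : HasFDerivAt b b' x₀) (hmc : ∀ᶠ x in 𝓝 x₀, BddContOff S (fun s => m s x) p q)
    {K : ℝ} (hmb : ∀ᶠ x in 𝓝 x₀, ∀ s ∈ Icc p q \ S, ‖m s x‖ ≤ K * ‖x - x₀‖)
    (hmd : ∀ s ∈ Icc p q \ S, HasFDerivAt (m s) (m' s) x₀)
    (hyc : ∀ᶠ x in 𝓝 x₀, ContinuousOn (fun t => y t x) (Icc p q))
    (heq : ∀ᶠ x in 𝓝 x₀, ∀ t ∈ Icc p q, y t x - y t x₀ =
      b x - b x₀ + ∫ s in p..t, (A s (y s x - y s x₀) + m s x)) :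
    ∃ w : ℝ → E →L[ℝ] X, ContinuousOn w (Icc p q) ∧
      ∀ t ∈ Icc p q, HasFDerivAt (y t) (w t) x₀ := by
  have hp : p ∈ Icc p q := ⟨le_rfl, hpq⟩
  have hm'i := hm'.intervalIntegrable hS hpq
  have hbc : ContinuousOn (fun t => b' + ∫ s in p..t, m' s) (Icc p q) := by
    have := intervalIntegral.continuousOn_primitive_interval' hm'i
      (by rw [uIcc_of_le hpq]; exact hp : p ∈ uIcc p q)
    rw [uIcc_of_le hpq] at this
    exact continuousOn_const.add this
  obtain ⟨w, hwc, hw⟩ := exists_eq_add_integral_clm hS hpq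
    (hA.clm_const (ContinuousLinearMap.compL ℝ E X X)) hbc
  refine ⟨w, hwc, fun t ht => ?_⟩
  obtain ⟨M, hM⟩ := hA.bound
  obtain ⟨C, hC⟩ := hm'.bound
  set M' := max M 0
  have hM' : ∀ s ∈ Icc p q \ S, ‖A s‖ ≤ M' := fun s hs => (hM s hs).trans (le_max_left _ _)
  have hAw := (hA.clm_const (ContinuousLinearMap.compL ℝ E X X)).clm_apply (hwc.bddContOff S)
  have hm0 : ∀ s ∈ Icc p q \ S, m s x₀ = 0 := fun s hs => by
    simpa using hmb.self_of_nhds s hs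
  have hρ : Tendsto (fun x => ∫ s in p..q, ‖x - x₀‖⁻¹ * ‖m s x - m' s (x - x₀)‖) (𝓝 x₀)
      (𝓝 (∫ _ in p..q, (0 : ℝ))) := by
    refine intervalIntegral.tendsto_integral_filter_of_dominated_convergence (fun _ => |K| + |C|)
      ?_ ?_ intervalIntegrable_const ?_
    · filter_upwards [hmc] with x hx
      have h1 : BddContOff S (fun s => m' s (x - x₀)) p q :=
        hm'.clm_apply (continuousOn_const.bddContOff S)
      exact (((hx.sub h1).norm.intervalIntegrable hS hpq).const_mul
        ‖x - x₀‖⁻¹).def'.aestronglyMeasurable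
    · filter_upwards [hmb] with x hx
      refine ae_of_forall_notMem hS fun s hs => ?_
      rw [uIoc_of_le hpq] at hs
      have hs' : s ∈ Icc p q \ S := ⟨⟨hs.1.1.le, hs.1.2⟩, hs.2⟩
      have h1 : ‖m s x - m' s (x - x₀)‖ ≤ (K + C) * ‖x - x₀‖ :=
        calc _ ≤ ‖m s x‖ + ‖m' s (x - x₀)‖ := norm_sub_le _ _
          _ ≤ K * ‖x - x₀‖ + C * ‖x - x₀‖ :=
            add_le_add (hx s hs') ((m' s).le_of_opNorm_le (hC s hs') _)
          _ = _ := by ring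
      rw [norm_mul, norm_inv, norm_norm, norm_norm]
      rcases eq_or_ne x x₀ with rfl | hne
      · simp only [sub_self, norm_zero, inv_zero, zero_mul]
        positivity
      · have : 0 < ‖x - x₀‖ := norm_pos_iff.2 (sub_ne_zero.2 hne)
        rw [inv_mul_le_iff₀ this]
        refine h1.trans (le_of_eq_of_le (mul_comm _ _) ?_)
        gcongr <;> exact le_abs_self _
    · refine ae_of_forall_notMem hS fun s hs => ?_
      rw [uIoc_of_le hpq] at hs
      have hs' : s ∈ Icc p q \ S := ⟨⟨hs.1.1.le, hs.1.2⟩, hs.2⟩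
      simpa [hm0 s hs'] using hasFDerivAt_iff_tendsto.1 (hmd s hs')
  rw [hasFDerivAt_iff_tendsto] at hb ⊢
  have hlim := (hb.add hρ).mul_const (Real.exp (M' * (q - p)))
  simp only [intervalIntegral.integral_zero, add_zero, zero_mul] at hlim
  refine squeeze_zero' (Eventually.of_forall fun x => by positivity) ?_ hlim
  filter_upwards [hmc, hyc, heq] with x hxc hxy hx
  have h1 : BddContOff S (fun s => m' s (x - x₀)) p q :=
    hm'.clm_apply (continuousOn_const.bddContOff S)
  have hδc : ContinuousOn (fun s => y s x - y s x₀) (Icc p q) := hxy.sub hyc.self_of_nhds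
  have hec : ContinuousOn (fun s => y s x - y s x₀ - w s (x - x₀)) (Icc p q) :=
    hδc.sub (hwc.clm_apply continuousOn_const)
  have key := norm_le_of_eq_add_integral hS (u := fun s => y s x - y s x₀ - w s (x - x₀))
    (k := fun s => A s (y s x - y s x₀ - w s (x - x₀)) + (m s x - m' s (x - x₀)))
    (ρ := fun s => ‖m s x - m' s (x - x₀)‖) (u₀ := b x - b x₀ - b' (x - x₀)) (K := M') hpq
    (le_max_right _ _) hec ((hxc.sub h1).norm.intervalIntegrable hS hpq)
    (fun _ => norm_nonneg _) ?_ ?_ t ht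
  · rw [intervalIntegral.integral_const_mul, ← mul_add, mul_assoc]
    exact mul_le_mul_of_nonneg_left key (by positivity)
  · intro r hr
    have i1 := ((hA.clm_apply (hδc.bddContOff S)).add hxc).intervalIntegrable hS hpq
      |>.sub_Icc hp hr
    have i2 := (hAw.intervalIntegrable hS hpq).sub_Icc hp hr
    have i3 := hm'i.sub_Icc hp hr
    have i4 := ((hA.clm_apply ((hwc.clm_apply continuousOn_const).bddContOff S)).add
      h1).intervalIntegrable hS hpq |>.sub_Icc hp hr (g := fun s => A s (w s (x - x₀)) +
        m' s (x - x₀))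
    have h2 : w r (x - x₀) = b' (x - x₀) + ∫ s in p..r, (A s (w s (x - x₀)) + m' s (x - x₀)) := by
      rw [hw r hr, add_assoc, ← intervalIntegral.integral_add i3 i2, add_apply,
        ContinuousLinearMap.intervalIntegral_apply (i3.add i2)]
      congr 1
      refine intervalIntegral.integral_congr fun s _ => ?_
      simp [add_comm]
    rw [hx r hr, h2, add_sub_add_comm, ← intervalIntegral.integral_sub i1 i4]
    congr 1
    refine intervalIntegral.integral_congr fun s _ => ?_
    simp only [map_sub]
    abel
  · intro s hs
    refine (norm_add_le _ _).trans (add_le_add ?_ le_rfl)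
    exact (A s).le_of_opNorm_le (hM' s hs) _

/-- The previous result for equations that run backwards from `q`. -/
lemma exists_hasFDerivAt_of_eq_add_integral_right (hS : S.Finite) (hpq : p ≤ q) {y : ℝ → E → X}
    {x₀ : E} {A : ℝ → X →L[ℝ] X} {m : ℝ → E → X} {m' : ℝ → E →L[ℝ] X} {b : E → X}
    {b' : E →L[ℝ] X} (hA : BddContOff S A p q) (hm' : BddContOff S m' p q)
    (hb : HasFDerivAt b b' x₀) (hmc : ∀ᶠ x in 𝓝 x₀, BddContOff S (fun s => m s x) p q)
    {K : ℝ} (hmb : ∀ᶠ x in 𝓝 x₀, ∀ s ∈ Icc p q \ S, ‖m s x‖ ≤ K * ‖x - x₀‖)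
    (hmd : ∀ s ∈ Icc p q \ S, HasFDerivAt (m s) (m' s) x₀)
    (hyc : ∀ᶠ x in 𝓝 x₀, ContinuousOn (fun t => y t x) (Icc p q))
    (heq : ∀ᶠ x in 𝓝 x₀, ∀ t ∈ Icc p q, y t x - y t x₀ =
      b x - b x₀ + ∫ s in t..q, (A s (y s x - y s x₀) + m s x)) :
    ∃ w : ℝ → E →L[ℝ] X, ContinuousOn w (Icc p q) ∧
      ∀ t ∈ Icc p q, HasFDerivAt (y t) (w t) x₀ := by
  have hmem : ∀ t ∈ Icc p q, p + q - t ∈ Icc p q :=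
    fun t ht => ⟨by linarith [ht.2], by linarith [ht.1]⟩
  obtain ⟨w, hwc, hw⟩ := exists_hasFDerivAt_of_eq_add_integral (finite_reverse hS (p + q)) hpq
    (y := fun t => y (p + q - t)) (m := fun t => m (p + q - t)) hA.reverse hm'.reverse hb
    (hmc.mono fun x hx => hx.reverse)
    (hmb.mono fun x hx s hs => hx _ ⟨hmem s hs.1, hs.2⟩)
    (fun s hs => hmd _ ⟨hmem s hs.1, hs.2⟩)
    (hyc.mono fun x hx => continuousOn_reverse hx)
    (heq.mono fun x hx t ht => by
      rw [hx _ (hmem t ht), ← intervalIntegral_reverse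
        (fun s => A s (y s x - y s x₀) + m s x)])
  refine ⟨fun t => w (p + q - t), continuousOn_reverse hwc, fun t ht => ?_⟩
  simpa using hw _ (hmem t ht)

end Parameter

/-! ### Trajectories and multipliers as solutions of integral equations -/

section Bounds

lemma exists_bound_of_eventually {W Y : Type*} [TopologicalSpace W] [NormedAddCommGroup Y]
    {k B : Set W} (hk : IsCompact k) {g : W → Y}
    (h : ∀ w ∈ k, ∃ C, ∀ᶠ v in 𝓝[k] w, v ∈ B → ‖g v‖ ≤ C) :
    ∃ C, ∀ v ∈ k, v ∈ B → ‖g v‖ ≤ C := by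
  refine hk.induction_on (p := fun s => ∃ C, ∀ v ∈ s, v ∈ B → ‖g v‖ ≤ C) ⟨0, by simp⟩ ?_ ?_ ?_
  · rintro s t hst ⟨C, hC⟩
    exact ⟨C, fun v hv => hC v (hst hv)⟩
  · rintro s t ⟨C, hC⟩ ⟨D, hD⟩
    refine ⟨max C D, ?_⟩
    rintro v (hv | hv) hB
    · exact (hC v hv hB).trans (le_max_left _ _)
    · exact (hD v hv hB).trans (le_max_right _ _)
  · intro w hw
    obtain ⟨C, hC⟩ := h w hw
    exact ⟨_, hC, C, fun v hv => hv⟩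

lemma Filter.Tendsto.eventually_norm_le {W Y : Type*} [NormedAddCommGroup Y] {l : Filter W}
    {g : W → Y} {y : Y} (h : Tendsto g l (𝓝 y)) : ∀ᶠ v in l, ‖g v‖ ≤ ‖y‖ + 1 :=
  (h.norm.eventually (gt_mem_nhds (lt_add_one _))).mono fun _ hv => hv.le

lemma InvariantImbedding.PiecewiseContinuousOn.exists_bddContOff {Y : Type*}
    [NormedAddCommGroup Y] {g : ℝ → Y} {p q : ℝ} (hg : PiecewiseContinuousOn g p q) :
    ∃ S : Set ℝ, S.Finite ∧ BddContOff S g p q ∧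
      ∀ t ∈ Icc p q \ S, ContinuousWithinAt g (Icc p q) t := by
  set S := {t | t ∈ Icc p q ∧ ¬ ContinuousWithinAt g (Icc p q) t} with hS
  have hcont : ∀ t ∈ Icc p q \ S, ContinuousWithinAt g (Icc p q) t := fun t ht => by
    by_contra h
    exact ht.2 ⟨ht.1, h⟩
  refine ⟨S, hg.1, ⟨fun t ht => (hcont t ht).mono sdiff_subset, ?_⟩, hcont⟩
  obtain ⟨C, hC⟩ := exists_bound_of_eventually (B := Sᶜ) isCompact_Icc (g := g) fun t ht => by
    by_cases htS : t ∈ S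
    · obtain ⟨⟨l₁, h₁⟩, ⟨l₂, h₂⟩⟩ := hg.2 t ht
      refine ⟨max (‖l₁‖ + 1) (‖l₂‖ + 1), ?_⟩
      have e₁ := h₁.eventually_norm_le
      have e₂ := h₂.eventually_norm_le
      rw [eventually_nhdsWithin_iff] at e₁ e₂ ⊢
      filter_upwards [e₁, e₂] with v h1 h2 hv hvS
      rcases lt_trichotomy v t with h | rfl | h
      · exact (h2 ⟨hv, h⟩).trans (le_max_right _ _)
      · exact absurd htS hvS
      · exact (h1 ⟨hv, h⟩).trans (le_max_left _ _)
    · exact ⟨_, (hcont t ⟨ht, htS⟩).tendsto.eventually_norm_le.mono fun v hv _ => hv⟩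
  exact ⟨C, fun t ht => hC t ht.1 ht.2⟩

/-- Composition of a jointly continuous function with a continuous state and a piecewise
continuous control. -/
lemma ContinuousOn.bddContOff_comp {E P Y : Type*} [NormedAddCommGroup E] [ProperSpace E]
    [NormedAddCommGroup P] [ProperSpace P] [NormedAddCommGroup Y] {F : ℝ → E → P → Y}
    {a p q : ℝ} (hap : a ≤ p)
    (hF : ContinuousOn (fun w : ℝ × E × P => F w.1 w.2.1 w.2.2) (Icc a q ×ˢ univ))
    {S : Set ℝ} {θ : ℝ → P} (hθ : BddContOff S θ p q) {z : ℝ → E}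
    (hz : ContinuousOn z (Icc p q)) : BddContOff S (fun t => F t (z t) (θ t)) p q := by
  obtain ⟨C, hC⟩ := hθ.bound
  obtain ⟨r, hr⟩ := isCompact_Icc.exists_bound_of_continuousOn hz
  have hk : IsCompact (Icc p q ×ˢ (Metric.closedBall (0 : E) r ×ˢ Metric.closedBall (0 : P) C)) :=
    isCompact_Icc.prod ((isCompact_closedBall _ _).prod (isCompact_closedBall _ _))
  have hsub : Icc p q ⊆ Icc a q := Icc_subset_Icc_left hap
  obtain ⟨D, hD⟩ := hk.exists_bound_of_continuousOn
    (hF.mono (prod_mono hsub (subset_univ _)))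
  constructor
  · exact hF.comp (f := fun t => (t, z t, θ t))
      (continuousOn_id.prodMk ((hz.mono sdiff_subset).prodMk hθ.continuousOn))
      fun t ht => ⟨hsub ht.1, mem_univ _⟩
  · exact ⟨D, fun t ht => hD (t, z t, θ t)
      ⟨ht.1, by simpa using hr t ht.1, by simpa using hC t ht⟩⟩

end Bounds

section Uniqueness

variable {X : Type*} [NormedAddCommGroup X] [NormedSpace ℝ X] {S : Set ℝ} {p q : ℝ}

lemma eqOn_of_eq_add_integral (hS : S.Finite) (hpq : p ≤ q) {u₁ u₂ k₁ k₂ : ℝ → X} {u₀ : X}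
    {K : ℝ} (hu₁ : ContinuousOn u₁ (Icc p q)) (hu₂ : ContinuousOn u₂ (Icc p q))
    (hk₁ : BddContOff S k₁ p q) (hk₂ : BddContOff S k₂ p q)
    (h₁ : ∀ t ∈ Icc p q, u₁ t = u₀ + ∫ s in p..t, k₁ s)
    (h₂ : ∀ t ∈ Icc p q, u₂ t = u₀ + ∫ s in p..t, k₂ s)
    (hk : ∀ s ∈ Icc p q \ S, ‖k₁ s - k₂ s‖ ≤ K * ‖u₁ s - u₂ s‖) : EqOn u₁ u₂ (Icc p q) := by
  intro t ht
  have hp : p ∈ Icc p q := ⟨le_rfl, hpq⟩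
  have := norm_le_of_eq_add_integral hS (u := fun t => u₁ t - u₂ t) (k := fun t => k₁ t - k₂ t)
    (ρ := fun _ => 0) (u₀ := 0) (K := max K 0) hpq (le_max_right _ _) (hu₁.sub hu₂)
    intervalIntegrable_const (fun _ => le_rfl)
    (fun t ht => by
      rw [h₁ t ht, h₂ t ht, intervalIntegral.integral_sub
        ((hk₁.intervalIntegrable hS hpq).sub_Icc hp ht)
        ((hk₂.intervalIntegrable hS hpq).sub_Icc hp ht)]
      abel)
    (fun s hs => (hk s hs).trans <| by
      rw [add_zero]
      exact mul_le_mul_of_nonneg_right (le_max_left _ _) (norm_nonneg _)) t ht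
  simpa [sub_eq_zero] using this

lemma eqOn_of_eq_add_integral_right (hS : S.Finite) (hpq : p ≤ q) {u₁ u₂ k₁ k₂ : ℝ → X} {u₀ : X}
    {K : ℝ} (hu₁ : ContinuousOn u₁ (Icc p q)) (hu₂ : ContinuousOn u₂ (Icc p q))
    (hk₁ : BddContOff S k₁ p q) (hk₂ : BddContOff S k₂ p q)
    (h₁ : ∀ t ∈ Icc p q, u₁ t = u₀ + ∫ s in t..q, k₁ s)
    (h₂ : ∀ t ∈ Icc p q, u₂ t = u₀ + ∫ s in t..q, k₂ s)
    (hk : ∀ s ∈ Icc p q \ S, ‖k₁ s - k₂ s‖ ≤ K * ‖u₁ s - u₂ s‖) : EqOn u₁ u₂ (Icc p q) := by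
  have hmem : ∀ t ∈ Icc p q, p + q - t ∈ Icc p q :=
    fun t ht => ⟨by linarith [ht.2], by linarith [ht.1]⟩
  intro t ht
  have := eqOn_of_eq_add_integral (finite_reverse hS (p + q)) hpq (u₀ := u₀)
    (continuousOn_reverse hu₁) (continuousOn_reverse hu₂) hk₁.reverse hk₂.reverse
    (fun t ht => by rw [h₁ _ (hmem t ht), intervalIntegral_reverse])
    (fun t ht => by rw [h₂ _ (hmem t ht), intervalIntegral_reverse])
    (fun s hs => hk _ ⟨hmem s hs.1, hs.2⟩) (hmem t ht)
  simpa using this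

end Uniqueness

section Equations

variable {E P : Type*} [NormedAddCommGroup E] [InnerProductSpace ℝ E] [CompleteSpace E]
  {S : Set ℝ} {a p q : ℝ}

lemma InvariantImbedding.IsTrajectory.eq_add_integral [TopologicalSpace P] {f : ℝ → E → P → E}
    {θ : ℝ → P} {z : ℝ → E} {x : E} (hz : IsTrajectory f θ z p q x) (hS : S.Finite)
    (hθ : ∀ t ∈ Icc p q \ S, ContinuousWithinAt θ (Icc p q) t)
    (hk : BddContOff S (fun t => f t (z t) (θ t)) p q) :
    ∀ t ∈ Icc p q, z t = x + ∫ s in p..t, f s (z s) (θ s) := by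
  intro t ht
  have hpq := ht.1.trans ht.2
  rw [integral_eq_of_hasDerivAt_off_countable_of_le z (fun s => f s (z s) (θ s)) ht.1
    hS.countable (hz.continuousOn.mono (Icc_subset_Icc_right ht.2)) ?_
    ((hk.intervalIntegrable hS hpq).sub_Icc ⟨le_rfl, hpq⟩ ht), hz.initial]
  · abel
  · intro s hs
    have hs' : s ∈ Ioo p q := ⟨hs.1.1, hs.1.2.trans_le ht.2⟩
    exact (hz.deriv_eq s (Ioo_subset_Icc_self hs')
      (hθ s ⟨Ioo_subset_Icc_self hs', hs.2⟩)).hasDerivAt (Icc_mem_nhds hs'.1 hs'.2)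

/-- A continuous function `lam` that is stationary in the weak sense solves the adjoint equation
`-lam' = Aᵀ lam + g`. With `κ` the solution of `κ' = -(Aᵀ lam + g)`, `κ(q) = lam(q)`, integration
by parts turns stationarity into `∫ ⟪κ - lam, η'⟫ = 0`, and `η' = κ - lam` is admissible. -/
lemma eq_add_integral_of_stationary (hS : S.Finite) (hpq : p ≤ q) {A : ℝ → E →L[ℝ] E}
    {g lam : ℝ → E} (hA : BddContOff S A p q) (hg : BddContOff S g p q)
    (hlam : ContinuousOn lam (Icc p q))
    (hst : ∀ η dη : ℝ → E, ContinuousOn dη (Icc p q) →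
      (∀ t ∈ Icc p q, HasDerivWithinAt η (dη t) (Icc p q) t) → η p = 0 →
      (∫ t in p..q, (⟪lam t, A t (η t) - dη t⟫_ℝ + ⟪g t, η t⟫_ℝ)) + ⟪lam q, η q⟫_ℝ = 0) :
    ∀ t ∈ Icc p q, lam t = lam q +
      ∫ s in t..q, (ContinuousLinearMap.adjoint (A s) (lam s) + g s) := by
  set k : ℝ → E := fun s => ContinuousLinearMap.adjoint (A s) (lam s) + g s with hk_def
  have hAdj : BddContOff S (fun s => ContinuousLinearMap.adjoint (A s)) p q := by
    obtain ⟨C, hC⟩ := hA.bound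
    refine ⟨ContinuousLinearMap.adjoint.continuous.comp_continuousOn hA.continuousOn, C,
      fun t ht => ?_⟩
    rw [LinearIsometryEquiv.norm_map]
    exact hC t ht
  have hk : BddContOff S k p q := (hAdj.clm_apply (hlam.bddContOff S)).add hg
  have hki := hk.intervalIntegrable hS hpq
  have hp : p ∈ Icc p q := ⟨le_rfl, hpq⟩
  have hq : q ∈ Icc p q := ⟨hpq, le_rfl⟩
  set κ : ℝ → E := fun t => lam q + ∫ s in t..q, k s with hκ_def
  have hκ_eq : ∀ t ∈ Icc p q, κ t = κ p - ∫ s in p..t, k s := fun t ht => by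
    simp only [hκ_def]
    rw [← intervalIntegral.integral_add_adjacent_intervals (hki.sub_Icc hp ht)
      (hki.sub_Icc ht hq)]
    abel
  have hκc : ContinuousOn κ (Icc p q) := by
    have := intervalIntegral.continuousOn_primitive_interval' hki
      (by rw [uIcc_of_le hpq]; exact hp : p ∈ uIcc p q)
    rw [uIcc_of_le hpq] at this
    exact (continuousOn_const.sub this).congr hκ_eq
  have hκd : ∀ t ∈ Ioo p q \ S, HasDerivAt κ (-k t) t := by
    intro t ht
    have hopen : IsOpen (Ioo p q \ S) := isOpen_Ioo.sdiff hS.isClosed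
    have hcont : ContinuousOn k (Ioo p q \ S) :=
      hk.continuousOn.mono (sdiff_subset_sdiff_left Ioo_subset_Icc_self)
    exact ((intervalIntegral.integral_hasDerivAt_left
      (hki.sub_Icc (Ioo_subset_Icc_self ht.1) hq)
      (hcont.stronglyMeasurableAtFilter hopen t ht)
      (hcont.continuousAt (hopen.mem_nhds ht))).const_add (lam q))
  -- the variation `η` with `η' = κ - lam`
  set φ : ℝ → E := IccExtend hpq ((Icc p q).domRestrict fun t => κ t - lam t) with hφ_def
  have hφc : Continuous φ :=
    (continuousOn_iff_continuous_domRestrict.1 (hκc.sub hlam)).Icc_extend'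
  have hφ : ∀ t ∈ Icc p q, φ t = κ t - lam t := fun t ht => by
    simp [hφ_def, IccExtend_of_mem _ _ ht, domRestrict_apply]
  set η : ℝ → E := fun t => ∫ s in p..t, φ s with hη_def
  have hηd : ∀ t, HasDerivAt η (φ t) t := fun t => (hφc.integral_hasStrictDerivAt p t).hasDerivAt
  have hηc : Continuous η := continuous_iff_continuousAt.2 fun t => (hηd t).continuousAt
  have h0 := hst η φ hφc.continuousOn (fun t _ => (hηd t).hasDerivWithinAt) (by simp [hη_def])
  have hkη : IntervalIntegrable (fun t => ⟪k t, η t⟫_ℝ) volume p q :=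
    BddContOff.intervalIntegrable
      ((hk.clm_const (innerSL ℝ)).clm_apply (hηc.continuousOn.bddContOff S)) hS hpq
  have hcc : ∀ {u v : ℝ → E}, ContinuousOn u (Icc p q) → ContinuousOn v (Icc p q) →
      IntervalIntegrable (fun t => ⟪u t, v t⟫_ℝ) volume p q := fun hu hv => by
    refine ContinuousOn.intervalIntegrable ?_
    rw [uIcc_of_le hpq]
    exact hu.inner hv
  have hparts : ∫ t in p..q, (⟪κ t, φ t⟫_ℝ + ⟪-k t, η t⟫_ℝ) = ⟪κ q, η q⟫_ℝ - ⟪κ p, η p⟫_ℝ := by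
    refine integral_eq_of_hasDerivAt_off_countable_of_le (fun t => ⟪κ t, η t⟫_ℝ) _ hpq
      hS.countable (hκc.inner hηc.continuousOn)
      (fun t ht => (hκd t ht).inner ℝ (hηd t)) ?_
    simp only [inner_neg_left]
    exact (hcc hκc hφc.continuousOn).add hkη.neg
  have hη0 : η p = 0 := by simp [hη_def]
  have hκq : κ q = lam q := by simp [hκ_def]
  rw [hη0, hκq, inner_zero_right, sub_zero] at hparts
  have h1 : ∫ t in p..q, (⟪lam t, A t (η t) - φ t⟫_ℝ + ⟪g t, η t⟫_ℝ)
      = (∫ t in p..q, ⟪k t, η t⟫_ℝ) - ∫ t in p..q, ⟪lam t, φ t⟫_ℝ := by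
    rw [← intervalIntegral.integral_sub hkη (hcc hlam hφc.continuousOn)]
    refine intervalIntegral.integral_congr fun t _ => ?_
    simp only [hk_def, inner_add_left, ContinuousLinearMap.adjoint_inner_left, inner_sub_right]
    ring
  have h2 : ∫ t in p..q, (⟪κ t, φ t⟫_ℝ + ⟪-k t, η t⟫_ℝ)
      = (∫ t in p..q, ⟪κ t, φ t⟫_ℝ) - ∫ t in p..q, ⟪k t, η t⟫_ℝ := by
    rw [← intervalIntegral.integral_sub (hcc hκc hφc.continuousOn) hkη]
    refine intervalIntegral.integral_congr fun t _ => ?_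
    simp only [inner_neg_left]
    ring
  have h3 : ∫ t in p..q, ‖κ t - lam t‖ ^ 2 = 0 := by
    have : ∫ t in p..q, ‖κ t - lam t‖ ^ 2 =
        (∫ t in p..q, ⟪κ t, φ t⟫_ℝ) - ∫ t in p..q, ⟪lam t, φ t⟫_ℝ := by
      rw [← intervalIntegral.integral_sub (hcc hκc hφc.continuousOn) (hcc hlam hφc.continuousOn)]
      refine intervalIntegral.integral_congr fun t ht => ?_
      rw [uIcc_of_le hpq] at ht
      simp only [hφ t ht, ← inner_sub_left, real_inner_self_eq_norm_sq]
    rw [this]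
    linarith
  have h4 : ∀ t ∈ Icc p q, κ t = lam t := by
    by_contra! hne
    obtain ⟨t, ht, hne⟩ := hne
    rcases hpq.eq_or_lt with rfl | hlt
    · obtain rfl : t = p := le_antisymm ht.2 ht.1
      exact hne hκq
    have hpos : 0 < ∫ t in p..q, ‖κ t - lam t‖ ^ 2 :=
      intervalIntegral.integral_pos hlt ((hκc.sub hlam).norm.pow 2) (fun s _ => by positivity)
        ⟨t, ht, by have := norm_pos_iff.2 (sub_ne_zero.2 hne); positivity⟩
    exact hpos.ne' h3
  intro t ht
  rw [← h4 t ht]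

end Equations

/-! ### The imbedded system in feedback form -/

/-- The integral form of the imbedded system: `z(·; p, x)` is driven by the feedback dynamics `Φ`,
`lam(·; p, x)` solves the backward linear equation `-lam' = K(t, z) lam + G(t, z)` along it, and
`lam(t; p, x)` depends on `(p, x)` only through the state `z(t; p, x)`. -/
structure IsAdjointFlow {E : Type*} [NormedAddCommGroup E] [NormedSpace ℝ E] (Φ G : ℝ → E → E)
    (K : ℝ → E → E →L[ℝ] E) (z lam : ℝ → ℝ → E → E) (a q : ℝ) : Prop where
  z_cont : ∀ p ∈ Icc a q, ∀ x, ContinuousOn (fun t => z t p x) (Icc p q)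
  z_int : ∀ p ∈ Icc a q, ∀ x, IntervalIntegrable (fun t => Φ t (z t p x)) volume p q
  z_eq : ∀ p ∈ Icc a q, ∀ x, ∀ t ∈ Icc p q, z t p x = x + ∫ s in p..t, Φ s (z s p x)
  lam_cont : ∀ p ∈ Icc a q, ∀ x, ContinuousOn (fun t => lam t p x) (Icc p q)
  lam_int : ∀ p ∈ Icc a q, ∀ x,
    IntervalIntegrable (fun t => K t (z t p x) (lam t p x) + G t (z t p x)) volume p q
  lam_eq : ∀ p ∈ Icc a q, ∀ x, ∀ t ∈ Icc p q,
    lam t p x = lam q p x + ∫ s in t..q, (K s (z s p x) (lam s p x) + G s (z s p x))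
  lam_comp : ∀ p ∈ Icc a q, ∀ x, ∀ t ∈ Icc p q, lam t p x = lam t t (z t p x)

section Feedback

variable {E P : Type*} [NormedAddCommGroup E] [InnerProductSpace ℝ E] [FiniteDimensional ℝ E]
  [NormedAddCommGroup P] [ProperSpace P] {a q : ℝ} {f : ℝ → E → P → E} {R : ℝ → E → P → ℝ}
  {T : E → ℝ} {θ : ℝ → ℝ → E → P} {z lam : ℝ → ℝ → E → E}

lemma isAdjointFlow_of_imbedding
    (hf : ContinuousOn (fun w : ℝ × E × P => f w.1 w.2.1 w.2.2) (Icc a q ×ˢ univ))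
    (hfz : ∀ t ∈ Icc a q, ∀ u, Differentiable ℝ (fun y => f t y u))
    (hfz' : ContinuousOn (fun w : ℝ × E × P => zJac f w.1 w.2.1 w.2.2) (Icc a q ×ˢ univ))
    (hRz' : ContinuousOn (fun w : ℝ × E × P => zGrad R w.1 w.2.1 w.2.2) (Icc a q ×ˢ univ))
    (hθ : ∀ p ∈ Icc a q, ∀ x, PiecewiseContinuousOn (fun t => θ t p x) p q)
    (hz : ∀ p ∈ Icc a q, ∀ x, IsTrajectory f (fun t => θ t p x) (fun t => z t p x) p q x)
    (hlam : ∀ p ∈ Icc a q, ∀ x,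
      IsLagrangeMultiplier f R T (fun t => θ t p x) (fun t => z t p x) (fun t => lam t p x) p q)
    (himb : ∀ p s t : ℝ, a ≤ p → p ≤ s → s ≤ t → t ≤ q → ∀ x, θ t p x = θ t s (z s p x)) :
    IsAdjointFlow (imbedDyn f θ) (fun p x => zGrad R p x (imbed θ p x))
      (fun p x => ContinuousLinearMap.adjoint (zJac f p x (imbed θ p x))) z lam a q := by
  choose! S hS hSθ hSc using fun p hp x => (hθ p hp x).exists_bddContOff
  -- along trajectories the control is the feedback control
  have hfb : ∀ p ∈ Icc a q, ∀ x, ∀ t ∈ Icc p q, imbed θ t (z t p x) = θ t p x :=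
    fun p hp x t ht => (himb p t t hp.1 ht.1 le_rfl ht.2 x).symm
  have bf : ∀ p ∈ Icc a q, ∀ x,
      BddContOff (S p x) (fun t => f t (z t p x) (θ t p x)) p q := fun p hp x =>
    hf.bddContOff_comp hp.1 (hSθ p hp x) (hz p hp x).continuousOn
  have bJ : ∀ p ∈ Icc a q, ∀ x,
      BddContOff (S p x) (fun t => zJac f t (z t p x) (θ t p x)) p q := fun p hp x =>
    hfz'.bddContOff_comp hp.1 (hSθ p hp x) (hz p hp x).continuousOn
  have bG : ∀ p ∈ Icc a q, ∀ x,
      BddContOff (S p x) (fun t => zGrad R t (z t p x) (θ t p x)) p q := fun p hp x =>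
    hRz'.bddContOff_comp hp.1 (hSθ p hp x) (hz p hp x).continuousOn
  have bK : ∀ p ∈ Icc a q, ∀ x, BddContOff (S p x)
      (fun t => ContinuousLinearMap.adjoint (zJac f t (z t p x) (θ t p x))) p q :=
    fun p hp x => by
      obtain ⟨C, hC⟩ := (bJ p hp x).bound
      refine ⟨ContinuousLinearMap.adjoint.continuous.comp_continuousOn
        (bJ p hp x).continuousOn, C, fun t ht => ?_⟩
      rw [LinearIsometryEquiv.norm_map]
      exact hC t ht
  have bk : ∀ p ∈ Icc a q, ∀ x, BddContOff (S p x)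
      (fun t => ContinuousLinearMap.adjoint (zJac f t (z t p x) (θ t p x)) (lam t p x)
        + zGrad R t (z t p x) (θ t p x)) p q := fun p hp x =>
    ((bK p hp x).clm_apply ((hlam p hp x).continuousOn.bddContOff _)).add (bG p hp x)
  have zeq : ∀ p ∈ Icc a q, ∀ x, ∀ t ∈ Icc p q,
      z t p x = x + ∫ s in p..t, f s (z s p x) (θ s p x) := fun p hp x =>
    (hz p hp x).eq_add_integral (hS p hp x) (hSc p hp x) (bf p hp x)
  have leq : ∀ p ∈ Icc a q, ∀ x, ∀ t ∈ Icc p q, lam t p x = lam q p x +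
      ∫ s in t..q, (ContinuousLinearMap.adjoint (zJac f s (z s p x) (θ s p x)) (lam s p x)
        + zGrad R s (z s p x) (θ s p x)) := fun p hp x =>
    eq_add_integral_of_stationary (hS p hp x) hp.2 (bJ p hp x) (bG p hp x)
      (hlam p hp x).continuousOn fun η dη h1 h2 h3 => by
        rw [(hlam p hp x).terminal]
        exact (hlam p hp x).stationary η dη h1 h2 h3
  -- the trajectories form a flow, by uniqueness
  have zcomp : ∀ p ∈ Icc a q, ∀ x, ∀ s ∈ Icc p q,
      EqOn (fun t => z t p x) (fun t => z t s (z s p x)) (Icc s q) := by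
    intro p hp x s hs
    have hsa : s ∈ Icc a q := ⟨hp.1.trans hs.1, hs.2⟩
    have hsub : Icc s q ⊆ Icc p q := Icc_subset_Icc_left hs.1
    have hc₁ := (hz p hp x).continuousOn.mono hsub
    have hc₂ := (hz s hsa (z s p x)).continuousOn
    have hθeq : ∀ t ∈ Icc s q, θ t s (z s p x) = θ t p x := fun t ht =>
      (himb p s t hp.1 hs.1 ht.1 ht.2 x).symm
    obtain ⟨r₁, hr₁⟩ := isCompact_Icc.exists_bound_of_continuousOn hc₁
    obtain ⟨r₂, hr₂⟩ := isCompact_Icc.exists_bound_of_continuousOn hc₂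
    obtain ⟨C, hC⟩ := (hSθ p hp x).bound
    have hk : IsCompact (Icc s q ×ˢ
        (Metric.closedBall (0 : E) (max r₁ r₂) ×ˢ Metric.closedBall (0 : P) C)) :=
      isCompact_Icc.prod ((isCompact_closedBall _ _).prod (isCompact_closedBall _ _))
    obtain ⟨D, hD⟩ := hk.exists_bound_of_continuousOn
      (hfz'.mono (prod_mono (Icc_subset_Icc_left hsa.1) (subset_univ _)))
    refine eqOn_of_eq_add_integral ((hS p hp x).union (hS s hsa (z s p x))) hs.2
      (u₀ := z s p x) (K := D) hc₁ hc₂ ((bf p hp x).mono subset_union_left hs.1 le_rfl)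
      ((bf s hsa (z s p x)).mono subset_union_right le_rfl le_rfl) ?_ (zeq s hsa (z s p x)) ?_
    · intro t ht
      have hi := (bf p hp x).intervalIntegrable (hS p hp x) hp.2
      rw [zeq p hp x t (hsub ht), zeq p hp x s hs, add_assoc,
        intervalIntegral.integral_add_adjacent_intervals
          (hi.sub_Icc ⟨le_rfl, hp.2⟩ hs) (hi.sub_Icc hs (hsub ht))]
    · intro t ht
      have hta : t ∈ Icc a q := Icc_subset_Icc_left hsa.1 ht.1
      rw [hθeq t ht.1]
      refine (convex_closedBall (0 : E) (max r₁ r₂)).norm_image_sub_le_of_norm_fderiv_le (𝕜 := ℝ)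
        (f := fun y => f t y (θ t p x)) (fun y _ => hfz t hta _ y) (fun y hy => ?_) ?_ ?_
      · exact hD (t, y, θ t p x) ⟨ht.1, hy, by
          simpa using hC t ⟨hsub ht.1, fun h => ht.2 (Or.inl h)⟩⟩
      · simpa using Or.inr (hr₂ t ht.1)
      · simpa using Or.inl (hr₁ t ht.1)
  have lcomp : ∀ p ∈ Icc a q, ∀ x, ∀ s ∈ Icc p q, lam s p x = lam s s (z s p x) := by
    intro p hp x s hs
    have hsa : s ∈ Icc a q := ⟨hp.1.trans hs.1, hs.2⟩
    have hsub : Icc s q ⊆ Icc p q := Icc_subset_Icc_left hs.1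
    have hθeq : ∀ t ∈ Icc s q, θ t s (z s p x) = θ t p x := fun t ht =>
      (himb p s t hp.1 hs.1 ht.1 ht.2 x).symm
    have hzeq : ∀ t ∈ Icc s q, z t s (z s p x) = z t p x := fun t ht =>
      (zcomp p hp x s hs ht).symm
    have hq : lam q s (z s p x) = lam q p x := by
      rw [(hlam s hsa (z s p x)).terminal, (hlam p hp x).terminal, hzeq q ⟨hs.2, le_rfl⟩]
    obtain ⟨C, hC⟩ := (bK p hp x).bound
    refine eqOn_of_eq_add_integral_right ((hS p hp x).union (hS s hsa (z s p x))) hs.2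
      (u₀ := lam q p x) (K := C) (u₁ := fun t => lam t p x) (u₂ := fun t => lam t s (z s p x))
      ((hlam p hp x).continuousOn.mono hsub) (hlam s hsa (z s p x)).continuousOn
      ((bk p hp x).mono subset_union_left hs.1 le_rfl)
      ((bk s hsa (z s p x)).mono subset_union_right le_rfl le_rfl)
      (fun t ht => leq p hp x t (hsub ht)) (fun t ht => by rw [leq s hsa _ t ht, hq]) ?_
      ⟨le_rfl, hs.2⟩
    intro t ht
    rw [hθeq t ht.1, hzeq t ht.1, add_sub_add_right_eq_sub, ← map_sub]
    exact ContinuousLinearMap.le_of_opNorm_le _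
      (hC t ⟨hsub ht.1, fun h => ht.2 (Or.inl h)⟩) _
  refine ⟨fun p hp x => (hz p hp x).continuousOn, ?_, ?_, fun p hp x => (hlam p hp x).continuousOn,
    ?_, ?_, lcomp⟩
  · intro p hp x
    refine ((bf p hp x).intervalIntegrable (hS p hp x) hp.2).congr_uIoo fun t ht => ?_
    rw [uIoo_of_le hp.2] at ht
    replace ht := Ioo_subset_Icc_self ht
    simp only [imbedDyn, hfb p hp x t ht]
  · intro p hp x t ht
    rw [zeq p hp x t ht]
    congr 1
    refine intervalIntegral.integral_congr fun s hs => ?_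
    rw [uIcc_of_le ht.1] at hs
    simp only [imbedDyn, hfb p hp x s ⟨hs.1, hs.2.trans ht.2⟩]
  · intro p hp x
    refine ((bk p hp x).intervalIntegrable (hS p hp x) hp.2).congr_uIoo fun t ht => ?_
    rw [uIoo_of_le hp.2] at ht
    replace ht := Ioo_subset_Icc_self ht
    simp only [hfb p hp x t ht]
  · intro p hp x t ht
    rw [leq p hp x t ht]
    congr 1
    refine intervalIntegral.integral_congr fun s hs => ?_
    rw [uIcc_of_le ht.2] at hs
    simp only [hfb p hp x s ⟨ht.1.trans hs.1, hs.2⟩]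

end Feedback

/-! ### Short-time asymptotics along the flow -/

section Drift

lemma ContinuousWithinAt.exists_norm_sub_le {E Y : Type*} [NormedAddCommGroup E]
    [NormedAddCommGroup Y] {g : ℝ → E → Y} {a q p₀ : ℝ} {x₀ : E}
    (hg : ContinuousWithinAt (Function.uncurry g) (Icc a q ×ˢ univ) (p₀, x₀)) {ε : ℝ}
    (hε : 0 < ε) : ∃ δ > 0, ∀ t ∈ Icc a q, |t - p₀| < δ → ∀ y, ‖y - x₀‖ < δ →
      ‖g t y - g p₀ x₀‖ ≤ ε := by
  obtain ⟨δ, hδ, h⟩ := Metric.continuousWithinAt_iff.1 hg ε hε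
  refine ⟨δ, hδ, fun t ht htp y hy => ?_⟩
  have := h (x := (t, y)) ⟨ht, mem_univ _⟩ (by
    rw [Prod.dist_eq, max_lt_iff]
    exact ⟨by rwa [Real.dist_eq], by rwa [dist_eq_norm]⟩)
  rw [dist_eq_norm] at this
  exact this.le

variable {E : Type*} [NormedAddCommGroup E] [NormedSpace ℝ E]
  {Φ G : ℝ → E → E} {K : ℝ → E → E →L[ℝ] E} {z lam : ℝ → ℝ → E → E} {a q : ℝ}

/-- Short trajectories near a point of continuity of `Φ` are straight to first order, uniformly. -/
lemma IsAdjointFlow.state_drift [CompleteSpace E] (h : IsAdjointFlow Φ G K z lam a q) {p₀ : ℝ}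
    {x₀ : E} (hΦ : ContinuousWithinAt (Function.uncurry Φ) (Icc a q ×ˢ univ) (p₀, x₀)) {ε : ℝ}
    (hε : 0 < ε) : ∃ δ > 0, ∀ p ∈ Icc a q, |p - p₀| < δ → ∀ p' ∈ Icc p q, |p' - p₀| < δ →
      ∀ x, ‖x - x₀‖ < δ → ∀ t ∈ Icc p p',
        ‖z t p x - x₀‖ ≤ ε ∧ ‖z t p x - x - (t - p) • Φ p₀ x₀‖ ≤ ε * (t - p) := by
  obtain ⟨η, hη, hc⟩ := hΦ.exists_norm_sub_le hε
  set r := min ε (η / 2) with hr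
  have hr0 : 0 < r := lt_min hε (by positivity)
  set V := ‖Φ p₀ x₀‖ + ε with hV
  have hV0 : 0 < V := by positivity
  refine ⟨min η (min (r / 4) (r / (8 * V))), by positivity, ?_⟩
  intro p hp hpp p' hp' hpp' x hx
  simp only [lt_min_iff] at hpp hpp' hx
  have hsub : Icc p p' ⊆ Icc p q := Icc_subset_Icc_right hp'.2
  have hlen : ∀ t ∈ Icc p p', (t - p) * V ≤ r / 4 := by
    intro t ht
    have h1 := (abs_lt.1 hpp.2.2).1
    have h2 := (abs_lt.1 hpp'.2.2).2
    have h3 : t - p ≤ 2 * (r / (8 * V)) := by linarith [ht.2]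
    calc (t - p) * V ≤ 2 * (r / (8 * V)) * V := mul_le_mul_of_nonneg_right h3 hV0.le
      _ = r / 4 := by field_simp; norm_num
  -- the first-order expansion holds up to time `t` if the trajectory stays near `x₀` before `t`
  have key : ∀ t ∈ Icc p p', (∀ s ∈ Ico p t, ‖z s p x - x₀‖ / r ≤ 1) →
      ‖z t p x - x - (t - p) • Φ p₀ x₀‖ ≤ ε * (t - p) := by
    intro t ht hs
    rw [h.z_eq p hp x t (hsub ht), add_sub_cancel_left, ← intervalIntegral.integral_const,
      ← intervalIntegral.integral_sub ((h.z_int p hp x).sub_Icc ⟨le_rfl, hp.2⟩ (hsub ht))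
        intervalIntegrable_const]
    refine (intervalIntegral.norm_integral_le_of_norm_le_const_ae
      (ae_of_forall_notMem (finite_singleton t) fun s hs' => ?_)).trans_eq
        (by rw [abs_of_nonneg (sub_nonneg.2 ht.1)])
    rw [uIoc_of_le ht.1] at hs'
    have hst : s < t := lt_of_le_of_ne hs'.1.2 hs'.2
    have h1 := (div_le_one hr0).1 (hs s ⟨hs'.1.1.le, hst⟩)
    refine hc s ⟨hp.1.trans hs'.1.1.le, (hst.le.trans ht.2).trans hp'.2⟩ ?_ _ ?_
    · have h2 := abs_lt.1 hpp.1
      have h3 := abs_lt.1 hpp'.1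
      exact abs_lt.2 ⟨by linarith [hs'.1.1], by linarith [ht.2]⟩
    · have : r ≤ η / 2 := min_le_right _ _
      linarith
  have hb := le_of_forall_le_one_imp (u := fun t => ‖z t p x - x₀‖ / r) (c := 1 / 2)
    (p := p) (q := p') (by norm_num)
    ((((h.z_cont p hp x).mono hsub).sub continuousOn_const).norm.div_const r) (fun t ht hs => by
      have h1 := key t ht hs
      rw [div_le_iff₀ hr0]
      have h2 : ‖z t p x - x₀‖ ≤ ‖z t p x - x - (t - p) • Φ p₀ x₀‖ + ‖x - x₀‖
          + ‖(t - p) • Φ p₀ x₀‖ := by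
        refine le_trans (le_of_eq ?_) (norm_add₃_le)
        congr 1
        abel
      rw [norm_smul, Real.norm_of_nonneg (sub_nonneg.2 ht.1)] at h2
      have h3 := hlen t ht
      rw [hV, mul_add] at h3
      linarith [hx.2.1])
  intro t ht
  have hone : ∀ s ∈ Icc p p', ‖z s p x - x₀‖ / r ≤ 1 := fun s hs => (hb s hs).trans (by norm_num)
  refine ⟨((div_le_one hr0).1 (hone t ht)).trans (min_le_left _ _), key t ht fun s hs => ?_⟩
  exact hone s ⟨hs.1, hs.2.le.trans ht.2⟩

/-- The multiplier along short trajectories, to first order, uniformly over the trajectories near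
`x₀` on which it is near `l₀` at one end. -/
lemma IsAdjointFlow.multiplier_drift [CompleteSpace E] (h : IsAdjointFlow Φ G K z lam a q) {p₀ : ℝ}
    {x₀ : E} (hΦ : ContinuousWithinAt (Function.uncurry Φ) (Icc a q ×ˢ univ) (p₀, x₀))
    (hK : ContinuousWithinAt (Function.uncurry K) (Icc a q ×ˢ univ) (p₀, x₀))
    (hG : ContinuousWithinAt (Function.uncurry G) (Icc a q ×ˢ univ) (p₀, x₀)) (l₀ : E) {ε : ℝ}
    (hε : 0 < ε) : ∃ δ > 0, ∀ p ∈ Icc a q, |p - p₀| < δ → ∀ p' ∈ Icc p q, |p' - p₀| < δ →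
      ∀ x, ‖x - x₀‖ < δ → (‖lam p p x - l₀‖ < δ ∨ ‖lam p' p x - l₀‖ < δ) →
        ‖lam p' p x - lam p p x + (p' - p) • (K p₀ x₀ l₀ + G p₀ x₀)‖ ≤ ε * (p' - p) := by
  set ε₁ := min 1 (ε / (2 * (‖l₀‖ + 1))) with hε₁
  have hε₁0 : 0 < ε₁ := by positivity
  obtain ⟨η₁, hη₁, hcK⟩ := hK.exists_norm_sub_le hε₁0
  obtain ⟨η₂, hη₂, hcG⟩ := hG.exists_norm_sub_le hε₁0
  set η := min η₁ η₂
  have hη0 : 0 < η := lt_min hη₁ hη₂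
  obtain ⟨δ₁, hδ₁, hz⟩ := h.state_drift hΦ (half_pos hη0)
  set C := ‖K p₀ x₀‖ + 1 with hC
  have hC0 : 0 < C := by positivity
  set D := C * ‖l₀‖ + (‖G p₀ x₀‖ + 1) with hD
  have hD0 : 0 < D := by positivity
  refine ⟨min (min δ₁ η) (min (1 / (4 * C)) (ε / (4 * C * (1 + 2 * D)))), by positivity, ?_⟩
  intro p hp hpp p' hp' hpp' x hx hend
  set δ := min (min δ₁ η) (min (1 / (4 * C)) (ε / (4 * C * (1 + 2 * D)))) with hδ
  have hδ0 : 0 < δ := by positivity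
  have hδa : δ ≤ δ₁ := (min_le_left _ _).trans (min_le_left _ _)
  have hδb : δ ≤ η := (min_le_left _ _).trans (min_le_right _ _)
  have hδc : δ * (4 * C) ≤ 1 :=
    (le_div_iff₀ (by positivity)).1 ((min_le_right _ _).trans (min_le_left _ _))
  have hδd : δ * (4 * C * (1 + 2 * D)) ≤ ε :=
    (le_div_iff₀ (by positivity)).1 ((min_le_right _ _).trans (min_le_right _ _))
  have hsub : Icc p p' ⊆ Icc p q := Icc_subset_Icc_right hp'.2
  have hnear : ∀ s ∈ Icc p p', ‖K s (z s p x) - K p₀ x₀‖ ≤ ε₁ ∧ ‖G s (z s p x) - G p₀ x₀‖ ≤ ε₁ := by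
    intro s hs
    have h1 := (hz p hp (hpp.trans_le hδa) p' hp' (hpp'.trans_le hδa) x (hx.trans_le hδa) s hs).1
    have h2 : s ∈ Icc a q := ⟨hp.1.trans hs.1, hs.2.trans hp'.2⟩
    have h3 : |s - p₀| < η := by
      have h2 := abs_lt.1 (hpp.trans_le hδb)
      have h3 := abs_lt.1 (hpp'.trans_le hδb)
      exact abs_lt.2 ⟨by linarith [hs.1], by linarith [hs.2]⟩
    have h4 : ‖z s p x - x₀‖ < η := by linarith
    exact ⟨hcK s h2 (h3.trans_le (min_le_left _ _)) _ (h4.trans_le (min_le_left _ _)),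
      hcG s h2 (h3.trans_le (min_le_right _ _)) _ (h4.trans_le (min_le_right _ _))⟩
  have hKb : ∀ s ∈ Icc p p', ‖K s (z s p x)‖ ≤ C := fun s hs => by
    have := norm_le_norm_add_norm_sub' (K s (z s p x)) (K p₀ x₀)
    linarith [(hnear s hs).1, min_le_left 1 (ε / (2 * (‖l₀‖ + 1)))]
  have hGb : ∀ s ∈ Icc p p', ‖G s (z s p x)‖ ≤ ‖G p₀ x₀‖ + 1 := fun s hs => by
    have := norm_le_norm_add_norm_sub' (G s (z s p x)) (G p₀ x₀)
    linarith [(hnear s hs).2, min_le_left 1 (ε / (2 * (‖l₀‖ + 1)))]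
  have hint : ∀ s ∈ Icc p p', ∀ t ∈ Icc p p', lam s p x - lam t p x =
      ∫ r in s..t, (K r (z r p x) (lam r p x) + G r (z r p x)) := by
    intro s hs t ht
    have hi := h.lam_int p hp x
    rw [h.lam_eq p hp x s (hsub hs), h.lam_eq p hp x t (hsub ht),
      ← intervalIntegral.integral_add_adjacent_intervals (hi.sub_Icc (hsub hs) (hsub ht))
        (hi.sub_Icc (hsub ht) ⟨hp.2, le_rfl⟩)]
    abel
  have hpI : p ∈ Icc p p' := ⟨le_rfl, hp'.1⟩
  have hpI' : p' ∈ Icc p p' := ⟨hp'.1, le_rfl⟩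
  obtain ⟨e, he, hel⟩ : ∃ e ∈ Icc p p', ‖lam e p x - l₀‖ < δ :=
    hend.elim (fun h => ⟨p, hpI, h⟩) fun h => ⟨p', hpI', h⟩
  -- the largest deviation `m` from `l₀` is small, because the time interval is short
  obtain ⟨τ, hτ, hmax⟩ := isCompact_Icc.exists_isMaxOn ⟨p, hpI⟩
    ((((h.lam_cont p hp x).mono hsub).sub (continuousOn_const (c := l₀))).norm)
  set m := ‖lam τ p x - l₀‖ with hm
  have hmb : ∀ s ∈ Icc p p', ‖lam s p x - l₀‖ ≤ m := fun s hs => hmax hs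
  have hm0 : 0 ≤ m := norm_nonneg _
  have hmain : m ≤ δ + (C * m + D) * (2 * δ) := by
    have h1 : ‖lam τ p x - lam e p x‖ ≤ (C * m + D) * |e - τ| := by
      rw [hint τ hτ e he]
      refine intervalIntegral.norm_integral_le_of_norm_le_const fun s hs => ?_
      have hs' : s ∈ Icc p p' := uIcc_subset_Icc hτ he (uIoc_subset_uIcc hs)
      have h2 : ‖lam s p x‖ ≤ ‖l₀‖ + m :=
        (norm_le_norm_add_norm_sub' _ l₀).trans (by linarith [hmb s hs'])
      calc _ ≤ ‖K s (z s p x) (lam s p x)‖ + ‖G s (z s p x)‖ := norm_add_le _ _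
        _ ≤ C * (‖l₀‖ + m) + (‖G p₀ x₀‖ + 1) :=
          add_le_add (ContinuousLinearMap.le_of_opNorm_le_of_le _ (hKb s hs') h2) (hGb s hs')
        _ = C * m + D := by rw [hD]; ring
    have h3 : |e - τ| ≤ 2 * δ := by
      have h2 := abs_lt.1 hpp
      have h3 := abs_lt.1 hpp'
      exact abs_le.2 ⟨by linarith [hτ.2, he.1], by linarith [hτ.1, he.2]⟩
    have h4 : m ≤ ‖lam e p x - l₀‖ + ‖lam τ p x - lam e p x‖ := by
      refine le_trans (le_of_eq ?_) (norm_add_le _ _)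
      rw [hm]
      congr 1
      abel
    have h5 : (C * m + D) * |e - τ| ≤ (C * m + D) * (2 * δ) :=
      mul_le_mul_of_nonneg_left h3 (by positivity)
    linarith
  have hm1 : m ≤ 2 * δ * (1 + 2 * D) := by nlinarith
  have hm2 : C * m ≤ ε / 2 := by nlinarith [mul_le_mul_of_nonneg_left hm1 hC0.le]
  have hε₁' : ε₁ * (‖l₀‖ + 1) ≤ ε / 2 := by
    have : ε₁ * (2 * (‖l₀‖ + 1)) ≤ ε := (le_div_iff₀ (by positivity)).1 (min_le_right _ _)
    linarith
  have hfin : lam p' p x - lam p p x + (p' - p) • (K p₀ x₀ l₀ + G p₀ x₀) =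
      -∫ r in p..p', (K r (z r p x) (lam r p x) + G r (z r p x) - (K p₀ x₀ l₀ + G p₀ x₀)) := by
    rw [intervalIntegral.integral_sub ((h.lam_int p hp x).sub_Icc (hsub hpI) (hsub hpI'))
      intervalIntegrable_const, ← hint p hpI p' hpI', intervalIntegral.integral_const]
    abel
  rw [hfin, norm_neg]
  refine (intervalIntegral.norm_integral_le_of_norm_le_const fun s hs => ?_).trans_eq
    (by rw [abs_of_nonneg (sub_nonneg.2 hp'.1)])
  rw [uIoc_of_le hp'.1] at hs
  have hs' := Ioc_subset_Icc_self hs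
  calc _ = ‖K s (z s p x) (lam s p x - l₀) + (K s (z s p x) - K p₀ x₀) l₀
        + (G s (z s p x) - G p₀ x₀)‖ := by
        congr 1
        simp only [map_sub, sub_apply]
        abel
    _ ≤ C * m + ε₁ * ‖l₀‖ + ε₁ := norm_add₃_le.trans (add_le_add (add_le_add
        (ContinuousLinearMap.le_of_opNorm_le_of_le _ (hKb s hs') (hmb s hs'))
        (ContinuousLinearMap.le_of_opNorm_le _ (hnear s hs').1 _)) (hnear s hs').2)
    _ ≤ ε := by linarith

end Drift

/-! ### The differential equation for the imbedded adjoint -/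

section Equation

variable {E : Type*} [NormedAddCommGroup E] [NormedSpace ℝ E]
  {Φ G : ℝ → E → E} {K : ℝ → E → E →L[ℝ] E} {z lam : ℝ → ℝ → E → E} {a q : ℝ}

lemma hasFDerivWithinAt_uncurry_iff {g : ℝ → E → E} {L : ℝ × E →L[ℝ] E} {p₀ : ℝ} {x₀ : E} :
    HasFDerivWithinAt (Function.uncurry g) L (Icc a q ×ˢ univ) (p₀, x₀) ↔
      ∀ ε > 0, ∃ δ > 0, ∀ t ∈ Icc a q, |t - p₀| < δ → ∀ y, ‖y - x₀‖ < δ →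
        ‖g t y - g p₀ x₀ - L (t - p₀, y - x₀)‖ ≤ ε * (|t - p₀| + ‖y - x₀‖) := by
  rw [hasFDerivWithinAt_iff_isLittleO, Asymptotics.isLittleO_iff]
  have hsum : ∀ (s : ℝ) (v : E), ‖(s, v)‖ ≤ |s| + ‖v‖ ∧ |s| + ‖v‖ ≤ 2 * ‖(s, v)‖ := fun s v => by
    rw [Prod.norm_def, Real.norm_eq_abs]
    have h1 := le_max_left |s| ‖v‖
    have h2 := le_max_right |s| ‖v‖
    exact ⟨max_le (by linarith [norm_nonneg v]) (by linarith [abs_nonneg s]), by linarith⟩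
  constructor
  · intro h ε hε
    obtain ⟨δ, hδ, hd⟩ := Metric.eventually_nhds_iff.1
      (eventually_nhdsWithin_iff.1 (h hε))
    refine ⟨δ, hδ, fun t ht htp y hy => ?_⟩
    have := hd (y := (t, y)) (by
      rw [Prod.dist_eq, max_lt_iff]
      exact ⟨by rwa [Real.dist_eq], by rwa [dist_eq_norm]⟩) ⟨ht, mem_univ _⟩
    exact this.trans (mul_le_mul_of_nonneg_left (hsum _ _).1 hε.le)
  · intro h c hc
    obtain ⟨δ, hδ, hd⟩ := h (c / 2) (half_pos hc)
    refine eventually_nhdsWithin_iff.2 (Metric.eventually_nhds_iff.2 ⟨δ, hδ, ?_⟩)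
    rintro ⟨t, y⟩ hty ⟨ht, -⟩
    rw [Prod.dist_eq, max_lt_iff] at hty
    refine (hd t ht (by simpa [Real.dist_eq] using hty.1) y
      (by simpa [dist_eq_norm] using hty.2)).trans ?_
    have := mul_le_mul_of_nonneg_left (hsum (t - p₀) (y - x₀)).2 (half_pos hc).le
    refine this.trans (le_of_eq ?_)
    simp only [Prod.mk_sub_mk]
    ring

/-- Differentiating `t ↦ lam(t; p, x) = Λ(t, z(t; p, x))`. At the final time `q` no trajectory
starts into the domain, so the difference quotient is taken over trajectories that start at times
`p < q` in the same state. -/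
lemma IsAdjointFlow.fderivWithin_apply [CompleteSpace E] (h : IsAdjointFlow Φ G K z lam a q)
    (haq : a < q) {p₀ : ℝ} (hp₀ : p₀ ∈ Icc a q) {x₀ : E}
    (hΦ : ContinuousWithinAt (Function.uncurry Φ) (Icc a q ×ˢ univ) (p₀, x₀))
    (hK : ContinuousWithinAt (Function.uncurry K) (Icc a q ×ˢ univ) (p₀, x₀))
    (hG : ContinuousWithinAt (Function.uncurry G) (Icc a q ×ˢ univ) (p₀, x₀))
    {L : ℝ × E →L[ℝ] E}
    (hL : HasFDerivWithinAt (Function.uncurry fun t x => lam t t x) L (Icc a q ×ˢ univ) (p₀, x₀)) :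
    L (1, Φ p₀ x₀) = -(K p₀ x₀ (lam p₀ p₀ x₀) + G p₀ x₀) := by
  set c₀ := K p₀ x₀ (lam p₀ p₀ x₀) + G p₀ x₀ with hc₀
  set V := ‖Φ p₀ x₀‖ with hV
  have hest : ∀ ε : ℝ, 0 < ε → ε ≤ 1 → ‖L (1, Φ p₀ x₀) + c₀‖ ≤ ε * (‖L‖ + V + 4) := by
    intro ε hε hε1
    obtain ⟨δ₁, hδ₁, hz⟩ := h.state_drift hΦ hε
    obtain ⟨δ₂, hδ₂, hl⟩ := h.multiplier_drift hΦ hK hG (lam p₀ p₀ x₀) hε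
    obtain ⟨δ₃, hδ₃, hc⟩ := (hL.continuousWithinAt).exists_norm_sub_le (half_pos hδ₂)
    obtain ⟨δ₄, hδ₄, hd⟩ := hasFDerivWithinAt_uncurry_iff.1 hL ε hε
    obtain ⟨τ, hτ0, hτ1, hτ2, hτ3, hτ4, hτ5, p, p', hp, hpp, hpp', hp', hττ⟩ : ∃ τ > 0, τ < δ₁ ∧
        τ < δ₂ ∧ τ < δ₃ ∧ τ < δ₄ ∧ (V + 1) * τ < δ₄ ∧
        ∃ p p', a ≤ p ∧ p ≤ p₀ ∧ p₀ ≤ p' ∧ p' ≤ q ∧ p' - p = τ := by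
      have hV1 : 0 < V + 1 := by positivity
      set μ := min (min δ₁ δ₂) (min (min δ₃ δ₄) (δ₄ / (V + 1))) with hμ
      have hμ0 : 0 < μ := by positivity
      have hμ5 : (V + 1) * (μ / 2) < δ₄ := by
        have h1 : μ * (V + 1) ≤ δ₄ :=
          (le_div_iff₀ hV1).1 ((min_le_right _ _).trans (min_le_right _ _))
        nlinarith
      have hμ1 : μ ≤ δ₁ := (min_le_left _ _).trans (min_le_left _ _)
      have hμ2 : μ ≤ δ₂ := (min_le_left _ _).trans (min_le_right _ _)
      have hμ3 : μ ≤ δ₃ := ((min_le_right _ _).trans (min_le_left _ _)).trans (min_le_left _ _)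
      have hμ4 : μ ≤ δ₄ := ((min_le_right _ _).trans (min_le_left _ _)).trans (min_le_right _ _)
      have hsmall : ∀ σ : ℝ, 0 < σ → ∃ τ > 0, τ ≤ σ ∧ τ < δ₁ ∧ τ < δ₂ ∧ τ < δ₃ ∧ τ < δ₄ ∧
          (V + 1) * τ < δ₄ := by
        intro σ hσ
        have h2 : min (μ / 2) σ ≤ μ / 2 := min_le_left _ _
        refine ⟨min (μ / 2) σ, by positivity, min_le_right _ _, by linarith, by linarith,
          by linarith, by linarith, ?_⟩
        exact (mul_le_mul_of_nonneg_left h2 hV1.le).trans_lt hμ5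
      rcases hp₀.2.lt_or_eq with hlt | heq
      · obtain ⟨τ, h0, hσ, h1, h2, h3, h4, h5⟩ := hsmall (q - p₀) (by linarith)
        exact ⟨τ, h0, h1, h2, h3, h4, h5, p₀, p₀ + τ, hp₀.1, le_rfl, by linarith, by linarith,
          by ring⟩
      · obtain ⟨τ, h0, hσ, h1, h2, h3, h4, h5⟩ := hsmall (q - a) (by linarith)
        exact ⟨τ, h0, h1, h2, h3, h4, h5, p₀ - τ, p₀, by linarith, by linarith, le_rfl, heq.le,
          by ring⟩
    have hp1 : |p - p₀| ≤ τ := abs_le.2 ⟨by linarith, by linarith⟩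
    have hp1' : |p' - p₀| ≤ τ := abs_le.2 ⟨by linarith, by linarith⟩
    have hpI : p ∈ Icc a q := ⟨hp, by linarith⟩
    have hpI' : p' ∈ Icc p q := ⟨by linarith, hp'⟩
    have hx0 : ∀ δ : ℝ, 0 < δ → ‖x₀ - x₀‖ < δ := fun δ hδ => by simpa using hδ
    have e1 := (hz p hpI (hp1.trans_lt hτ1) p' hpI' (hp1'.trans_lt hτ1) x₀ (hx0 _ hδ₁) p'
      ⟨hpI'.1, le_rfl⟩).2
    have e2 := hl p hpI (hp1.trans_lt hτ2) p' hpI' (hp1'.trans_lt hτ2) x₀ (hx0 _ hδ₂)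
      (Or.inl ((hc p hpI (hp1.trans_lt hτ3) x₀ (hx0 _ hδ₃)).trans_lt (half_lt_self hδ₂)))
    rw [h.lam_comp p hpI x₀ p' hpI'] at e2
    set y := z p' p x₀ with hy
    rw [hττ] at e1 e2
    have hyx : ‖y - x₀‖ ≤ (V + 1) * τ := by
      have h1 : ‖y - x₀‖ ≤ ‖y - x₀ - τ • Φ p₀ x₀‖ + ‖τ • Φ p₀ x₀‖ := by
        simpa using norm_add_le (y - x₀ - τ • Φ p₀ x₀) (τ • Φ p₀ x₀)
      rw [norm_smul, Real.norm_of_nonneg hτ0.le] at h1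
      nlinarith
    have e3 := hd p hpI (hp1.trans_lt hτ4) x₀ (hx0 _ hδ₄)
    have e4 := hd p' ⟨hp.trans hpI'.1, hp'⟩ (hp1'.trans_lt hτ4) y (hyx.trans_lt hτ5)
    have e3' : ‖lam p p x₀ - lam p₀ p₀ x₀ - L (p - p₀, x₀ - x₀)‖ ≤ ε * τ :=
      e3.trans (by simpa using mul_le_mul_of_nonneg_left hp1 hε.le)
    have e4' : ‖lam p' p' y - lam p₀ p₀ x₀ - L (p' - p₀, y - x₀)‖ ≤ ε * ((V + 2) * τ) :=
      e4.trans (mul_le_mul_of_nonneg_left (by linarith) hε.le)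
    have e5 : ‖L (0, y - x₀ - τ • Φ p₀ x₀)‖ ≤ ‖L‖ * (ε * τ) :=
      L.le_opNorm_of_le (by rw [Prod.norm_def]; simpa using e1)
    have hLsplit : L (p' - p₀, y - x₀) - L (p - p₀, x₀ - x₀) =
        τ • L (1, Φ p₀ x₀) + L (0, y - x₀ - τ • Φ p₀ x₀) := by
      rw [← map_sub, ← map_smul, ← map_add]
      congr 1
      ext
      · simp [← hττ]
      · simp
    have hid : τ • (L (1, Φ p₀ x₀) + c₀) =
        (lam p' p' y - lam p p x₀ + τ • c₀)
        - (lam p' p' y - lam p₀ p₀ x₀ - L (p' - p₀, y - x₀))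
        + (lam p p x₀ - lam p₀ p₀ x₀ - L (p - p₀, x₀ - x₀))
        - L (0, y - x₀ - τ • Φ p₀ x₀) := by
      rw [eq_sub_iff_add_eq, smul_add]
      have := hLsplit
      rw [sub_eq_iff_eq_add] at this
      rw [this]
      abel
    have hn : τ * ‖L (1, Φ p₀ x₀) + c₀‖ ≤ τ * (ε * (‖L‖ + V + 4)) := by
      rw [← Real.norm_of_nonneg hτ0.le, ← norm_smul, Real.norm_of_nonneg hτ0.le, hid]
      refine (norm_sub_le _ _).trans ((add_le_add ((norm_add_le _ _).trans
        (add_le_add ((norm_sub_le _ _).trans (add_le_add e2 e4')) e3')) e5).trans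
        (le_of_eq (by ring)))
    exact le_of_mul_le_mul_left hn hτ0
  have hzero : ‖L (1, Φ p₀ x₀) + c₀‖ ≤ 0 := by
    refine le_of_forall_pos_le_add fun ε hε => ?_
    have hW : 0 < ‖L‖ + V + 4 := by positivity
    have := hest (min 1 (ε / (‖L‖ + V + 4))) (by positivity) (min_le_left _ _)
    refine this.trans ?_
    rw [zero_add, ← le_div_iff₀ hW]
    exact min_le_right _ _
  exact eq_neg_of_add_eq_zero_left (norm_le_zero_iff.1 hzero)

end Equation

/-! ### Differentiability in time and state from differentiability in the state -/

section Joint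

variable {E : Type*} [NormedAddCommGroup E] [NormedSpace ℝ E] [CompleteSpace E]
  {Φ G : ℝ → E → E} {K : ℝ → E → E →L[ℝ] E} {z lam : ℝ → ℝ → E → E} {a q : ℝ}

/-- The flow maps over short times cover a fixed neighbourhood: `x ↦ z(p; p₀, x) - x` is a small
contraction, so that `z(p; p₀, x) = y` can be solved for `x`. -/
lemma IsAdjointFlow.exists_state_eq (h : IsAdjointFlow Φ G K z lam a q) {p₀ : ℝ}
    (hp₀ : p₀ ∈ Icc a q) {x₀ : E}
    (hΦ : ContinuousWithinAt (Function.uncurry Φ) (Icc a q ×ˢ univ) (p₀, x₀)) {S : Set ℝ}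
    (hS : S.Finite) {ρ C : ℝ} (hρ : 0 < ρ)
    (hlip : ∀ t ∈ Icc a q \ S, ∀ x ∈ Metric.closedBall x₀ ρ, ∀ y ∈ Metric.closedBall x₀ ρ,
      ‖Φ t x - Φ t y‖ ≤ C * ‖x - y‖) {r : ℝ} (hr : 0 < r) :
    ∃ δ > 0, ∀ p ∈ Icc p₀ q, p - p₀ < δ → ∀ y, ‖y - x₀‖ < δ →
      ∃ x, ‖x - x₀‖ < r ∧ z p p₀ x = y := by
  obtain ⟨δ₁, hδ₁, hz⟩ := h.state_drift hΦ hρ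
  set V := ‖Φ p₀ x₀‖ + ρ with hV
  have hV0 : 0 < V := by positivity
  set r' := min (r / 2) (δ₁ / 2) with hr'
  have hr'0 : 0 < r' := by positivity
  set C' := max C 1 with hC'
  have hC'0 : 0 < C' := lt_max_of_lt_right one_pos
  refine ⟨min (min δ₁ (r' / 2)) (min (1 / (3 * C')) (r' / (2 * V))), by positivity, ?_⟩
  intro p hp hpδ y hy
  simp only [lt_min_iff] at hpδ hy
  have hlen0 : 0 ≤ p - p₀ := sub_nonneg.2 hp.1
  have hlen1 : (p - p₀) * C' ≤ 1 / 3 := by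
    have := (lt_div_iff₀ (by positivity)).1 hpδ.2.1
    linarith
  have hlen2 : (p - p₀) * V ≤ r' / 2 := by
    have := (lt_div_iff₀ (by positivity)).1 hpδ.2.2
    linarith
  have hd : ∀ x, ‖x - x₀‖ ≤ r' → ∀ t ∈ Icc p₀ p,
      ‖z t p₀ x - x₀‖ ≤ ρ ∧ ‖z t p₀ x - x - (t - p₀) • Φ p₀ x₀‖ ≤ ρ * (t - p₀) := fun x hx =>
    hz p₀ hp₀ (by simpa using hδ₁) p hp (by rw [abs_of_nonneg hlen0]; exact hpδ.1.1) x
      (hx.trans_lt ((min_le_right _ _).trans_lt (half_lt_self hδ₁)))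
  have hsub : Icc p₀ p ⊆ Icc p₀ q := Icc_subset_Icc_right hp.2
  have hpI : p ∈ Icc p₀ p := ⟨hp.1, le_rfl⟩
  -- the displacements over `[p₀, p]` are `1/2`-Lipschitz in the initial state
  have hcontr : ∀ x, ‖x - x₀‖ ≤ r' → ∀ x', ‖x' - x₀‖ ≤ r' →
      ‖(z p p₀ x - x) - (z p p₀ x' - x')‖ ≤ 1 / 2 * ‖x - x'‖ := by
    intro x hx x' hx'
    obtain ⟨τ, hτ, hmax⟩ := isCompact_Icc.exists_isMaxOn ⟨p, hpI⟩
      (((h.z_cont p₀ hp₀ x).sub (h.z_cont p₀ hp₀ x')).mono hsub).norm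
    set m := ‖z τ p₀ x - z τ p₀ x'‖ with hm
    have hm0 : 0 ≤ m := norm_nonneg _
    have hmb : ∀ t ∈ Icc p₀ p, ‖z t p₀ x - z t p₀ x'‖ ≤ m := fun t ht => hmax ht
    have hdiff : ∀ t ∈ Icc p₀ p,
        ‖(z t p₀ x - x) - (z t p₀ x' - x')‖ ≤ C' * m * (p - p₀) := by
      intro t ht
      rw [h.z_eq p₀ hp₀ x t (hsub ht), h.z_eq p₀ hp₀ x' t (hsub ht), add_sub_cancel_left,
        add_sub_cancel_left, ← intervalIntegral.integral_sub
          ((h.z_int p₀ hp₀ x).sub_Icc ⟨le_rfl, hp₀.2⟩ (hsub ht))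
          ((h.z_int p₀ hp₀ x').sub_Icc ⟨le_rfl, hp₀.2⟩ (hsub ht))]
      refine (intervalIntegral.norm_integral_le_of_norm_le_const_ae
        (ae_of_forall_notMem hS fun s hs => ?_)).trans (mul_le_mul_of_nonneg_left
          (by rw [abs_of_nonneg (sub_nonneg.2 ht.1)]; linarith [ht.2]) (by positivity))
      rw [uIoc_of_le ht.1] at hs
      have hs' : s ∈ Icc p₀ p := ⟨hs.1.1.le, hs.1.2.trans ht.2⟩
      refine (hlip s ⟨⟨hp₀.1.trans hs'.1, hs'.2.trans hp.2⟩, hs.2⟩ _ ?_ _ ?_).trans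
        (mul_le_mul (le_max_left _ _) (hmb s hs') (norm_nonneg _) hC'0.le)
      · simpa [dist_eq_norm] using (hd x hx s hs').1
      · simpa [dist_eq_norm] using (hd x' hx' s hs').1
    have h1 : m ≤ ‖x - x'‖ + C' * m * (p - p₀) := by
      refine le_trans ?_ (add_le_add_right (hdiff τ hτ) _)
      refine le_trans (le_of_eq ?_) (norm_add_le _ _)
      rw [hm]
      congr 1
      abel
    have h2 : C' * m * (p - p₀) ≤ 1 / 3 * m := by nlinarith
    linarith [hdiff p hpI]
  set F : E → E := fun x => y - (z p p₀ x - x) with hF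
  have hmaps : MapsTo F (Metric.closedBall x₀ r') (Metric.closedBall x₀ r') := by
    intro x hx
    rw [Metric.mem_closedBall, dist_eq_norm] at hx ⊢
    have h1 := (hd x hx p hpI).2
    have h2 : ‖z p p₀ x - x‖ ≤ ‖z p p₀ x - x - (p - p₀) • Φ p₀ x₀‖ + ‖(p - p₀) • Φ p₀ x₀‖ := by
      simpa using norm_add_le (z p p₀ x - x - (p - p₀) • Φ p₀ x₀) ((p - p₀) • Φ p₀ x₀)
    rw [norm_smul, Real.norm_of_nonneg hlen0] at h2
    have h3 : ‖F x - x₀‖ ≤ ‖y - x₀‖ + ‖z p p₀ x - x‖ := by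
      refine le_trans (le_of_eq ?_) (norm_sub_le _ _)
      congr 1
      simp only [hF]
      abel
    rw [hV, mul_add] at hlen2
    linarith [hy.1.2]
  have hcw : ContractingWith (1 / 2) (hmaps.restrict F _ _) := by
    refine ⟨by norm_num, LipschitzWith.of_dist_le_mul fun x x' => ?_⟩
    have hx := x.2
    have hx' := x'.2
    rw [Metric.mem_closedBall, dist_eq_norm] at hx hx'
    rw [Subtype.dist_eq, Subtype.dist_eq, dist_eq_norm, dist_eq_norm, MapsTo.val_restrict_apply,
      MapsTo.val_restrict_apply]
    simp only [hF]
    rw [sub_sub_sub_cancel_left, norm_sub_rev]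
    simpa using hcontr x hx x' hx'
  obtain ⟨x, hx, hfix, -⟩ := hcw.exists_fixedPoint' Metric.isClosed_closedBall.isComplete hmaps
    (Metric.mem_closedBall_self hr'0.le) (edist_ne_top _ _)
  rw [Metric.mem_closedBall, dist_eq_norm] at hx
  refine ⟨x, hx.trans_lt ((min_le_left _ _).trans_lt (half_lt_self hr)), ?_⟩
  have h1 : y - (z p p₀ x - x) = x := hfix
  have h2 : y - z p p₀ x = 0 := by
    rw [← sub_eq_zero] at h1
    rw [← h1]
    abel
  exact (sub_eq_zero.1 h2).symm

/-- Every `(p, y)` near `(p₀, x₀)` is joined to some `(p₀, x)` by a short trajectory, which starts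
at `(p, y)` if `p ≤ p₀` and arrives there if `p ≥ p₀`. -/
lemma IsAdjointFlow.exists_connecting (h : IsAdjointFlow Φ G K z lam a q) {p₀ : ℝ}
    (hp₀ : p₀ ∈ Icc a q) {x₀ : E}
    (hΦ : ContinuousWithinAt (Function.uncurry Φ) (Icc a q ×ˢ univ) (p₀, x₀))
    (hK : ContinuousWithinAt (Function.uncurry K) (Icc a q ×ˢ univ) (p₀, x₀))
    (hG : ContinuousWithinAt (Function.uncurry G) (Icc a q ×ˢ univ) (p₀, x₀)) {S : Set ℝ}
    (hS : S.Finite) {ρ C : ℝ} (hρ : 0 < ρ)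
    (hlip : ∀ t ∈ Icc a q \ S, ∀ x ∈ Metric.closedBall x₀ ρ, ∀ y ∈ Metric.closedBall x₀ ρ,
      ‖Φ t x - Φ t y‖ ≤ C * ‖x - y‖) (hΛ : ContinuousAt (fun x => lam p₀ p₀ x) x₀) {ε : ℝ}
    (hε : 0 < ε) :
    ∃ δ > 0, ∀ p ∈ Icc a q, |p - p₀| < δ → ∀ y, ‖y - x₀‖ < δ → ∃ x,
      ‖x - y - (p₀ - p) • Φ p₀ x₀‖ ≤ ε * |p - p₀| ∧
      ‖lam p p y - lam p₀ p₀ x - (p₀ - p) • (K p₀ x₀ (lam p₀ p₀ x₀) + G p₀ x₀)‖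
        ≤ ε * |p - p₀| := by
  set c₀ := K p₀ x₀ (lam p₀ p₀ x₀) + G p₀ x₀ with hc₀
  obtain ⟨δ₁, hδ₁, hz⟩ := h.state_drift hΦ hε
  obtain ⟨δ₂, hδ₂, hl⟩ := h.multiplier_drift hΦ hK hG (lam p₀ p₀ x₀) hε
  obtain ⟨δ₃, hδ₃, hc⟩ := Metric.continuousAt_iff.1 hΛ δ₂ hδ₂
  obtain ⟨δ₄, hδ₄, hz'⟩ := h.state_drift hΦ (half_pos hδ₃)
  obtain ⟨δ₅, hδ₅, hsol⟩ := h.exists_state_eq hp₀ hΦ hS hρ hlip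
    (lt_min (lt_min hδ₁ hδ₂) hδ₃)
  refine ⟨min (min δ₁ δ₂) (min δ₄ δ₅), by positivity, ?_⟩
  intro p hp hpp y hy
  simp only [lt_min_iff] at hpp hy
  have h00 : ∀ δ : ℝ, 0 < δ → |p₀ - p₀| < δ := fun δ hδ => by simpa using hδ
  rcases le_total p p₀ with hle | hle
  · have hpI : p₀ ∈ Icc p q := ⟨hle, hp₀.2⟩
    have hpI' : p₀ ∈ Icc p p₀ := ⟨hle, le_rfl⟩
    have e1 := (hz p hp hpp.1.1 p₀ hpI (h00 _ hδ₁) y hy.1.1 p₀ hpI').2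
    have e2 := (hz' p hp hpp.2.1 p₀ hpI (h00 _ hδ₄) y hy.2.1 p₀ hpI').1
    have e3 : ‖lam p₀ p y - lam p₀ p₀ x₀‖ < δ₂ := by
      rw [h.lam_comp p hp y p₀ hpI, ← dist_eq_norm]
      exact hc (by rw [dist_eq_norm]; exact e2.trans_lt (half_lt_self hδ₃))
    have e4 := hl p hp hpp.1.2 p₀ hpI (h00 _ hδ₂) y hy.1.2 (Or.inr e3)
    rw [abs_sub_comm, abs_of_nonneg (sub_nonneg.2 hle)]
    refine ⟨z p₀ p y, e1, ?_⟩
    rw [h.lam_comp p hp y p₀ hpI] at e4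
    rw [← norm_neg]
    refine le_trans (le_of_eq ?_) e4
    congr 1
    abel
  · have hpI : p ∈ Icc p₀ q := ⟨hle, hp.2⟩
    rw [abs_of_nonneg (sub_nonneg.2 hle)]
    rw [abs_of_nonneg (sub_nonneg.2 hle)] at hpp
    obtain ⟨x, hx, hxy⟩ := hsol p hpI hpp.2.2 y hy.2.2
    simp only [lt_min_iff] at hx
    have hpa : ∀ δ, p - p₀ < δ → |p - p₀| < δ := fun δ hδ => by
      rwa [abs_of_nonneg (sub_nonneg.2 hle)]
    have e1 := (hz p₀ hp₀ (h00 _ hδ₁) p hpI (hpa _ hpp.1.1) x hx.1.1 p ⟨hle, le_rfl⟩).2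
    have e3 : ‖lam p₀ p₀ x - lam p₀ p₀ x₀‖ < δ₂ := by
      rw [← dist_eq_norm]
      exact hc (by rw [dist_eq_norm]; exact hx.2)
    have e4 := hl p₀ hp₀ (h00 _ hδ₂) p hpI (hpa _ hpp.1.2) x hx.1.2 (Or.inl e3)
    rw [h.lam_comp p₀ hp₀ x p hpI, hxy] at e4
    rw [hxy] at e1
    refine ⟨x, ?_, ?_⟩
    · rw [← norm_neg]
      refine le_trans (le_of_eq ?_) e1
      congr 1
      rw [← neg_sub p p₀, neg_smul]
      abel
    · refine le_trans (le_of_eq ?_) e4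
      congr 1
      rw [← neg_sub p p₀, neg_smul]
      abel

/-- Differentiability of the imbedded adjoint in the state, at the single time `p₀`, implies joint
differentiability in time and state at `(p₀, x₀)`. -/
lemma IsAdjointFlow.differentiableWithinAt (h : IsAdjointFlow Φ G K z lam a q) {p₀ : ℝ}
    (hp₀ : p₀ ∈ Icc a q) {x₀ : E}
    (hΦ : ContinuousWithinAt (Function.uncurry Φ) (Icc a q ×ˢ univ) (p₀, x₀))
    (hK : ContinuousWithinAt (Function.uncurry K) (Icc a q ×ˢ univ) (p₀, x₀))
    (hG : ContinuousWithinAt (Function.uncurry G) (Icc a q ×ˢ univ) (p₀, x₀)) {S : Set ℝ}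
    (hS : S.Finite) {ρ C : ℝ} (hρ : 0 < ρ)
    (hlip : ∀ t ∈ Icc a q \ S, ∀ x ∈ Metric.closedBall x₀ ρ, ∀ y ∈ Metric.closedBall x₀ ρ,
      ‖Φ t x - Φ t y‖ ≤ C * ‖x - y‖)
    (hΛ : DifferentiableAt ℝ (fun x => lam p₀ p₀ x) x₀) :
    DifferentiableWithinAt ℝ (Function.uncurry fun t x => lam t t x) (Icc a q ×ˢ univ)
      (p₀, x₀) := by
  obtain ⟨D, hD⟩ := hΛ
  set c₀ := K p₀ x₀ (lam p₀ p₀ x₀) + G p₀ x₀ with hc₀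
  set V := ‖Φ p₀ x₀‖ with hV
  -- the time derivative is the one that the differential equation prescribes
  refine ⟨D.comp (ContinuousLinearMap.snd ℝ ℝ E) -
    (ContinuousLinearMap.fst ℝ ℝ E).smulRight (D (Φ p₀ x₀) + c₀), ?_⟩
  rw [hasFDerivWithinAt_uncurry_iff]
  intro ε' hε'
  have hW : 0 < V + 3 + ‖D‖ := by positivity
  set ε := min 1 (ε' / (V + 3 + ‖D‖)) with hε
  have hε0 : 0 < ε := by positivity
  have hε1 : ε ≤ 1 := min_le_left _ _
  have hεW : ε * (V + 3 + ‖D‖) ≤ ε' := (le_div_iff₀ hW).1 (min_le_right _ _)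
  obtain ⟨δ₁, hδ₁, hd⟩ := Metric.eventually_nhds_iff.1
    (Asymptotics.isLittleO_iff.1 (hasFDerivAt_iff_isLittleO.1 hD) hε0)
  obtain ⟨δ₂, hδ₂, hcon⟩ := h.exists_connecting hp₀ hΦ hK hG hS hρ hlip hD.continuousAt hε0
  refine ⟨min (δ₁ / (V + 2)) δ₂, by positivity, ?_⟩
  intro p hp hpp y hy
  simp only [lt_min_iff] at hpp hy
  obtain ⟨x, hx1, hx2⟩ := hcon p hp hpp.2 y hy.2
  set τ := |p - p₀| with hτ
  have hτ0 : 0 ≤ τ := abs_nonneg _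
  have hxx : ‖x - x₀‖ ≤ ‖y - x₀‖ + (V + 1) * τ := by
    have h1 : ‖x - x₀‖ ≤ ‖y - x₀‖ + ‖x - y - (p₀ - p) • Φ p₀ x₀‖ + ‖(p₀ - p) • Φ p₀ x₀‖ := by
      refine le_trans (le_of_eq ?_) norm_add₃_le
      congr 1
      abel
    rw [norm_smul, Real.norm_eq_abs, abs_sub_comm] at h1
    nlinarith
  have hxδ : ‖x - x₀‖ < δ₁ := by
    have h1 := (lt_div_iff₀ (by positivity)).1 hpp.1
    have h2 := (lt_div_iff₀ (by positivity)).1 hy.1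
    have h3 : (V + 2) * ‖x - x₀‖ < (V + 2) * δ₁ := by
      have h4 := mul_le_mul_of_nonneg_left hxx (by positivity : 0 ≤ V + 2)
      have h5 := mul_lt_mul_of_pos_left h1 (by positivity : 0 < V + 1)
      linarith
    exact lt_of_mul_lt_mul_left h3 (by positivity)
  have e1 := hd (y := x) (by rwa [dist_eq_norm])
  have e2 : ‖D (x - y - (p₀ - p) • Φ p₀ x₀)‖ ≤ ‖D‖ * (ε * τ) := D.le_opNorm_of_le hx1
  have hid : lam p p y - lam p₀ p₀ x₀ - (D.comp (ContinuousLinearMap.snd ℝ ℝ E) -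
      (ContinuousLinearMap.fst ℝ ℝ E).smulRight (D (Φ p₀ x₀) + c₀)) (p - p₀, y - x₀) =
      (lam p p y - lam p₀ p₀ x - (p₀ - p) • c₀)
      + (lam p₀ p₀ x - lam p₀ p₀ x₀ - D (x - x₀))
      + D (x - y - (p₀ - p) • Φ p₀ x₀) := by
    simp only [sub_apply, ContinuousLinearMap.comp_apply, ContinuousLinearMap.coe_snd',
      ContinuousLinearMap.smulRight_apply, ContinuousLinearMap.coe_fst', map_sub, map_smul]
    rw [← neg_sub p p₀, neg_smul, neg_smul, smul_add]
    abel
  rw [hid]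
  refine (norm_add₃_le.trans (add_le_add (add_le_add hx2 e1) e2)).trans ?_
  have h3 : ε * ‖x - x₀‖ ≤ ε * (‖y - x₀‖ + (V + 1) * τ) := mul_le_mul_of_nonneg_left hxx hε0.le
  have h4 : ε * (V + 3 + ‖D‖) * (τ + ‖y - x₀‖) ≤ ε' * (τ + ‖y - x₀‖) :=
    mul_le_mul_of_nonneg_right hεW (by positivity)
  have h5 : 0 ≤ ε * (V + 2 + ‖D‖) * ‖y - x₀‖ := by positivity
  nlinarith

end Joint

/-! ### Regularity of the coefficients -/

section Regular

lemma InvariantImbedding.PiecewiseContinuousInTimeOn.continuousOn_and_bound {X Y : Type*}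
    [NormedAddCommGroup X] [NormedAddCommGroup Y] {g : ℝ → X → Y} {a b : ℝ}
    (hg : PiecewiseContinuousInTimeOn g a b) : ∃ S : Set ℝ, S.Finite ∧
      ContinuousOn (Function.uncurry g) ((Icc a b \ S) ×ˢ univ) ∧
      ∀ k : Set X, IsCompact k → ∃ C, ∀ t ∈ Icc a b \ S, ∀ x ∈ k, ‖g t x‖ ≤ C := by
  set S := {t | t ∈ Icc a b ∧
    ∃ x, ¬ ContinuousWithinAt (Function.uncurry g) (Icc a b ×ˢ univ) (t, x)} with hS
  have hcont : ∀ t ∈ Icc a b \ S, ∀ x,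
      ContinuousWithinAt (Function.uncurry g) (Icc a b ×ˢ univ) (t, x) := fun t ht x => by
    by_contra h
    exact ht.2 ⟨ht.1, x, h⟩
  refine ⟨S, hg.1, fun w hw => (hcont w.1 hw.1 w.2).mono
    (prod_mono sdiff_subset Subset.rfl), fun k hk => ?_⟩
  obtain ⟨C, hC⟩ := exists_bound_of_eventually (B := Sᶜ ×ˢ univ) (isCompact_Icc.prod hk)
    (g := Function.uncurry g) (k := Icc a b ×ˢ k) fun w hw => by
      obtain ⟨t, x⟩ := w
      by_cases htS : t ∈ S
      · obtain ⟨⟨l₁, h₁⟩, ⟨l₂, h₂⟩⟩ := hg.2 t hw.1 x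
        refine ⟨max (‖l₁‖ + 1) (‖l₂‖ + 1), ?_⟩
        have e₁ := h₁.eventually_norm_le
        have e₂ := h₂.eventually_norm_le
        rw [eventually_nhdsWithin_iff] at e₁ e₂ ⊢
        filter_upwards [e₁, e₂] with v h1 h2 hv hvS
        rcases lt_trichotomy v.1 t with h | h | h
        · exact (h2 ⟨⟨hv.1, h⟩, mem_univ _⟩).trans (le_max_right _ _)
        · exact absurd (h ▸ htS) hvS.1
        · exact (h1 ⟨⟨hv.1, h⟩, mem_univ _⟩).trans (le_max_left _ _)
      · exact ⟨_, (((hcont t ⟨hw.1, htS⟩ x).mono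
          (prod_mono Subset.rfl (subset_univ k))).tendsto.eventually_norm_le).mono
            fun v hv _ => hv⟩
  exact ⟨C, fun t ht x hx => hC (t, x) ⟨ht.1, hx⟩ ⟨ht.2, mem_univ _⟩⟩

variable {X Y W : Type*} [NormedAddCommGroup X] [NormedSpace ℝ X] [NormedAddCommGroup Y]
  [NormedSpace ℝ Y] [NormedAddCommGroup W] [NormedSpace ℝ W] {S : Set ℝ} {a b p q : ℝ}

lemma BddContOff.clm_comp {A : ℝ → Y →L[ℝ] W} {V : ℝ → X →L[ℝ] Y} (hA : BddContOff S A p q)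
    (hV : BddContOff S V p q) : BddContOff S (fun t => (A t).comp (V t)) p q :=
  (hA.clm_const (ContinuousLinearMap.compL ℝ X Y W)).clm_apply hV

lemma BddContOff.clm_flip_apply {A : ℝ → X →L[ℝ] Y →L[ℝ] W} {g : ℝ → Y}
    (hA : BddContOff S A p q) (hg : BddContOff S g p q) :
    BddContOff S (fun t => (A t).flip (g t)) p q := by
  obtain ⟨C, hC⟩ := hA.bound
  have hflip : BddContOff S (fun t => (A t).flip) p q :=
    ⟨(ContinuousLinearMap.flipₗᵢ ℝ X Y W).continuous.comp_continuousOn hA.continuousOn, C,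
      fun t ht => by rw [ContinuousLinearMap.opNorm_flip]; exact hC t ht⟩
  exact hflip.clm_apply hg

/-- What is used of `C1InState`: off the exceptional set `S` of times, `g` and its derivative in
the state are jointly continuous, and they are bounded on compact sets of states, uniformly in
time. -/
structure RegularInState (S : Set ℝ) (g : ℝ → X → Y) (a b : ℝ) : Prop where
  differentiable : ∀ t ∈ Icc a b, Differentiable ℝ (g t)
  continuousOn : ContinuousOn (Function.uncurry g) ((Icc a b \ S) ×ˢ univ)
  continuousOn_fderiv :
    ContinuousOn (Function.uncurry fun t x => fderiv ℝ (g t) x) ((Icc a b \ S) ×ˢ univ)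
  bound : ∀ k : Set X, IsCompact k → ∃ C, ∀ t ∈ Icc a b \ S, ∀ x ∈ k,
    ‖g t x‖ ≤ C ∧ ‖fderiv ℝ (g t) x‖ ≤ C

lemma InvariantImbedding.C1InState.exists_regularInState {g : ℝ → X → Y} (hg : C1InState g a b) :
    ∃ S : Set ℝ, S.Finite ∧ RegularInState S g a b := by
  obtain ⟨hd, h₁, h₂⟩ := hg
  obtain ⟨S₁, hS₁, c₁, b₁⟩ := h₁.continuousOn_and_bound
  obtain ⟨S₂, hS₂, c₂, b₂⟩ := h₂.continuousOn_and_bound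
  refine ⟨S₁ ∪ S₂, hS₁.union hS₂, hd,
    c₁.mono (prod_mono (sdiff_subset_sdiff_right subset_union_left) Subset.rfl),
    c₂.mono (prod_mono (sdiff_subset_sdiff_right subset_union_right) Subset.rfl), fun k hk => ?_⟩
  obtain ⟨C, hC⟩ := b₁ k hk
  obtain ⟨D, hD⟩ := b₂ k hk
  exact ⟨max C D, fun t ht x hx =>
    ⟨(hC t ⟨ht.1, fun h => ht.2 (Or.inl h)⟩ x hx).trans (le_max_left _ _),
      (hD t ⟨ht.1, fun h => ht.2 (Or.inr h)⟩ x hx).trans (le_max_right _ _)⟩⟩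

lemma RegularInState.mono {g : ℝ → X → Y} (hg : RegularInState S g a b) {S' : Set ℝ}
    (hS : S ⊆ S') : RegularInState S' g a b := by
  refine ⟨hg.differentiable,
    hg.continuousOn.mono (prod_mono (sdiff_subset_sdiff_right hS) Subset.rfl),
    hg.continuousOn_fderiv.mono (prod_mono (sdiff_subset_sdiff_right hS) Subset.rfl),
    fun k hk => ?_⟩
  obtain ⟨C, hC⟩ := hg.bound k hk
  exact ⟨C, fun t ht => hC t ⟨ht.1, fun h => ht.2 (hS h)⟩⟩

lemma RegularInState.clm_comp {g : ℝ → X → Y} (hg : RegularInState S g a b) (L : Y →L[ℝ] W) :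
    RegularInState S (fun t x => L (g t x)) a b := by
  have hfd : ∀ t ∈ Icc a b, ∀ x, fderiv ℝ (fun x => L (g t x)) x = L.comp (fderiv ℝ (g t) x) :=
    fun t ht x => (L.hasFDerivAt.comp x (hg.differentiable t ht x).hasFDerivAt).fderiv
  refine ⟨fun t ht => L.differentiable.comp (hg.differentiable t ht),
    L.continuous.comp_continuousOn hg.continuousOn, ?_, fun k hk => ?_⟩
  · refine ((ContinuousLinearMap.compL ℝ X Y W L).continuous.comp_continuousOn
      hg.continuousOn_fderiv).congr fun w hw => ?_
    exact hfd w.1 hw.1.1 w.2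
  · obtain ⟨C, hC⟩ := hg.bound k hk
    refine ⟨‖L‖ * C, fun t ht x hx => ⟨L.le_opNorm_of_le (hC t ht x hx).1, ?_⟩⟩
    rw [hfd t ht.1]
    exact (L.opNorm_comp_le _).trans
      (mul_le_mul_of_nonneg_left (hC t ht x hx).2 (norm_nonneg _))

lemma RegularInState.bddContOff_comp {g : ℝ → X → Y} (hg : RegularInState S g a q) (hap : a ≤ p)
    {w : ℝ → X} (hw : ContinuousOn w (Icc p q)) : BddContOff S (fun t => g t (w t)) p q := by
  have hsub : Icc p q ⊆ Icc a q := Icc_subset_Icc_left hap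
  obtain ⟨C, hC⟩ := hg.bound _ (isCompact_Icc.image_of_continuousOn hw)
  refine ⟨hg.continuousOn.comp (f := fun t => (t, w t))
    (continuousOn_id.prodMk (hw.mono sdiff_subset))
      fun t ht => ⟨⟨hsub ht.1, ht.2⟩, mem_univ _⟩, C, fun t ht => ?_⟩
  exact (hC t ⟨hsub ht.1, ht.2⟩ _ (mem_image_of_mem w ht.1)).1

lemma RegularInState.bddContOff_fderiv_comp {g : ℝ → X → Y} (hg : RegularInState S g a q)
    (hap : a ≤ p) {w : ℝ → X} (hw : ContinuousOn w (Icc p q)) :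
    BddContOff S (fun t => fderiv ℝ (g t) (w t)) p q := by
  have hsub : Icc p q ⊆ Icc a q := Icc_subset_Icc_left hap
  obtain ⟨C, hC⟩ := hg.bound _ (isCompact_Icc.image_of_continuousOn hw)
  refine ⟨hg.continuousOn_fderiv.comp (f := fun t => (t, w t))
    (continuousOn_id.prodMk (hw.mono sdiff_subset))
      fun t ht => ⟨⟨hsub ht.1, ht.2⟩, mem_univ _⟩, C, fun t ht => ?_⟩
  exact (hC t ⟨hsub ht.1, ht.2⟩ _ (mem_image_of_mem w ht.1)).2

lemma RegularInState.exists_bound_and_lipschitz {g : ℝ → X → Y} [ProperSpace X]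
    (hg : RegularInState S g a b) (c : X) (r : ℝ) : ∃ C, 0 ≤ C ∧ ∀ t ∈ Icc a b \ S,
      ∀ x ∈ Metric.closedBall c r, ‖g t x‖ ≤ C ∧ ‖fderiv ℝ (g t) x‖ ≤ C ∧
        ∀ y ∈ Metric.closedBall c r, ‖g t x - g t y‖ ≤ C * ‖x - y‖ := by
  obtain ⟨C, hC⟩ := hg.bound _ (isCompact_closedBall c r)
  refine ⟨max C 0, le_max_right _ _, fun t ht x hx => ?_⟩
  have h : ∀ y ∈ Metric.closedBall c r, ‖fderiv ℝ (g t) y‖ ≤ max C 0 :=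
    fun y hy => (hC t ht y hy).2.trans (le_max_left _ _)
  exact ⟨(hC t ht x hx).1.trans (le_max_left _ _), h x hx, fun y hy =>
    (convex_closedBall c r).norm_image_sub_le_of_norm_fderiv_le (𝕜 := ℝ)
      (fun y _ => hg.differentiable t ht.1 y) h hy hx⟩

end Regular

/-! ### Differentiability of the imbedded adjoint in the state -/

section StateDerivative

/-- Product rule where one factor vanishes and is differentiable and the other one is merely
continuous. -/
lemma HasFDerivAt.clm_apply_of_eq_zero {E X Y : Type*} [NormedAddCommGroup E] [NormedSpace ℝ E]
    [NormedAddCommGroup X] [NormedSpace ℝ X] [NormedAddCommGroup Y] [NormedSpace ℝ Y]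
    {κ : E → X →L[ℝ] Y} {κ' : E →L[ℝ] X →L[ℝ] Y} {l : E → X} {x₀ : E} (hκ : HasFDerivAt κ κ' x₀)
    (h0 : κ x₀ = 0) (hl : ContinuousAt l x₀) :
    HasFDerivAt (fun x => κ x (l x)) (κ'.flip (l x₀)) x₀ := by
  rw [hasFDerivAt_iff_isLittleO] at hκ ⊢
  have h1 : (fun x => (κ x - κ x₀ - κ' (x - x₀)) (l x)) =o[𝓝 x₀] fun x => x - x₀ := by
    have hb : (fun x => (κ x - κ x₀ - κ' (x - x₀)) (l x)) =O[𝓝 x₀]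
        fun x => ‖κ x - κ x₀ - κ' (x - x₀)‖ * ‖l x‖ :=
      Asymptotics.IsBigO.of_bound 1 (Eventually.of_forall fun x => by
        rw [one_mul, norm_mul, norm_norm, norm_norm]
        exact ContinuousLinearMap.le_opNorm _ _)
    refine hb.trans_isLittleO ?_
    have := hκ.norm_norm.mul_isBigO (hl.norm.isBigO_one ℝ)
    simpa using this.norm_right
  have h2 : (fun x => κ' (x - x₀) (l x - l x₀)) =o[𝓝 x₀] fun x => x - x₀ := by
    have hb : (fun x => κ' (x - x₀) (l x - l x₀)) =O[𝓝 x₀]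
        fun x => ‖x - x₀‖ * ‖l x - l x₀‖ :=
      Asymptotics.IsBigO.of_bound ‖κ'‖ (Eventually.of_forall fun x => by
        rw [norm_mul, norm_norm, norm_norm, ← mul_assoc]
        exact κ'.le_opNorm₂ _ _)
    refine hb.trans_isLittleO ?_
    have hl0 : Tendsto (fun x => ‖l x - l x₀‖) (𝓝 x₀) (𝓝 0) := by
      simpa using (hl.sub (continuousAt_const (y := l x₀))).norm.tendsto
    have := (Asymptotics.isBigO_refl (fun x => ‖x - x₀‖) (𝓝 x₀)).mul_isLittleO
      ((Asymptotics.isLittleO_one_iff ℝ).2 hl0)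
    simpa using this.norm_right
  refine (h1.add h2).congr_left fun x => ?_
  simp only [h0, ContinuousLinearMap.flip_apply, sub_apply, map_sub, zero_apply]
  abel

variable {E : Type*} [NormedAddCommGroup E] [NormedSpace ℝ E] [ProperSpace E]
  {Φ G : ℝ → E → E} {K : ℝ → E → E →L[ℝ] E} {z lam : ℝ → ℝ → E → E} {a q : ℝ} {S : Set ℝ}

/-- Trajectories depend on their initial state in a Lipschitz way, near a given one. -/
lemma IsAdjointFlow.exists_state_lipschitz (h : IsAdjointFlow Φ G K z lam a q) (hS : S.Finite)
    (hΦ : RegularInState S Φ a q) {p : ℝ} (hp : p ∈ Icc a q) (x₀ : E) :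
    ∃ L, 0 ≤ L ∧ ∀ᶠ x in 𝓝 x₀, ∀ t ∈ Icc p q, ‖z t p x - z t p x₀‖ ≤ L * ‖x - x₀‖ ∧
      ‖z t p x - z t p x₀‖ ≤ 1 := by
  obtain ⟨r, hr⟩ := isCompact_Icc.exists_bound_of_continuousOn (h.z_cont p hp x₀)
  obtain ⟨C, hC0, hC⟩ := hΦ.exists_bound_and_lipschitz 0 (r + 1)
  set L := Real.exp (C * (q - p)) with hL
  have hL0 : 0 < L := Real.exp_pos _
  have hball : ∀ᶠ x in 𝓝 x₀, ‖x - x₀‖ < 1 / (2 * L) := by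
    filter_upwards [Metric.ball_mem_nhds x₀ (by positivity : 0 < 1 / (2 * L))] with x hx
    rwa [← dist_eq_norm]
  refine ⟨L, hL0.le, hball.mono fun x hx => ?_⟩
  have hxL : ‖x - x₀‖ * L ≤ 1 / 2 := by
    have := (lt_div_iff₀ (by positivity)).1 hx
    linarith
  have hpI : p ∈ Icc p q := ⟨le_rfl, hp.2⟩
  have hzc : ContinuousOn (fun t => z t p x - z t p x₀) (Icc p q) :=
    (h.z_cont p hp x).sub (h.z_cont p hp x₀)
  have key : ∀ t ∈ Icc p q, (∀ s ∈ Ico p t, ‖z s p x - z s p x₀‖ ≤ 1) →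
      ‖z t p x - z t p x₀‖ ≤ ‖x - x₀‖ * L := by
    intro t ht hs
    have hsub : Icc p t ⊆ Icc p q := Icc_subset_Icc_right ht.2
    have := norm_le_of_eq_add_integral (hS.union (finite_singleton t))
      (u := fun t => z t p x - z t p x₀) (k := fun t => Φ t (z t p x) - Φ t (z t p x₀))
      (ρ := fun _ => 0) (u₀ := x - x₀) (K := C) ht.1 hC0 (hzc.mono hsub) intervalIntegrable_const
      (fun _ => le_rfl) (fun s hs => by
        rw [h.z_eq p hp x s (hsub hs), h.z_eq p hp x₀ s (hsub hs), intervalIntegral.integral_sub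
          ((h.z_int p hp x).sub_Icc hpI (hsub hs)) ((h.z_int p hp x₀).sub_Icc hpI (hsub hs))]
        abel)
      (fun s hs' => by
        have hst : s < t := lt_of_le_of_ne hs'.1.2 fun h => hs'.2 (Or.inr h)
        have h1 := hs s ⟨hs'.1.1, hst⟩
        have h0 := hr s (hsub hs'.1)
        rw [add_zero]
        refine (hC s ⟨⟨hp.1.trans hs'.1.1, (hsub hs'.1).2⟩,
          fun h => hs'.2 (Or.inl h)⟩ _ ?_).2.2 _ ?_
        · rw [mem_closedBall_zero_iff]
          have := norm_le_norm_add_norm_sub' (z s p x) (z s p x₀)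
          linarith
        · rw [mem_closedBall_zero_iff]
          linarith) t ⟨ht.1, le_rfl⟩
    simp only [intervalIntegral.integral_zero, add_zero] at this
    refine this.trans (mul_le_mul_of_nonneg_left (Real.exp_le_exp.2 ?_) (norm_nonneg _))
    exact mul_le_mul_of_nonneg_left (by linarith [ht.2]) hC0
  have hb := le_of_forall_le_one_imp (u := fun t => ‖z t p x - z t p x₀‖) (c := 1 / 2)
    (by norm_num) hzc.norm fun t ht hs => (key t ht hs).trans hxL
  have hone : ∀ t ∈ Icc p q, ‖z t p x - z t p x₀‖ ≤ 1 := fun t ht =>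
    (hb t ht).trans (by norm_num)
  refine fun t ht => ⟨?_, hone t ht⟩
  rw [mul_comm]
  exact key t ht fun s hs => hone s ⟨hs.1, hs.2.le.trans ht.2⟩

/-- Trajectories are differentiable in their initial state. -/
lemma IsAdjointFlow.exists_hasFDerivAt_state (h : IsAdjointFlow Φ G K z lam a q) (hS : S.Finite)
    (hΦ : RegularInState S Φ a q) {p : ℝ} (hp : p ∈ Icc a q) (x₀ : E) :
    ∃ V : ℝ → E →L[ℝ] E, ContinuousOn V (Icc p q) ∧
      ∀ t ∈ Icc p q, HasFDerivAt (z t p) (V t) x₀ := by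
  obtain ⟨L, hL0, hL⟩ := h.exists_state_lipschitz hS hΦ hp x₀
  obtain ⟨r, hr⟩ := isCompact_Icc.exists_bound_of_continuousOn (h.z_cont p hp x₀)
  obtain ⟨C, hC0, hC⟩ := hΦ.exists_bound_and_lipschitz 0 (r + 1)
  have hpI : p ∈ Icc p q := ⟨le_rfl, hp.2⟩
  have hsubS : ∀ s ∈ Icc p q \ S, s ∈ Icc a q \ S :=
    fun s hs => ⟨⟨hp.1.trans hs.1.1, hs.1.2⟩, hs.2⟩
  have hA := hΦ.bddContOff_fderiv_comp hp.1 (h.z_cont p hp x₀)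
  have hmem₀ : ∀ s ∈ Icc p q, z s p x₀ ∈ Metric.closedBall 0 (r + 1) := fun s hs => by
    rw [mem_closedBall_zero_iff]
    linarith [hr s hs]
  have hmem : ∀ x, ∀ s ∈ Icc p q, ‖z s p x - z s p x₀‖ ≤ 1 →
      z s p x ∈ Metric.closedBall 0 (r + 1) := fun x s hs h1 => by
    rw [mem_closedBall_zero_iff]
    have := norm_le_norm_add_norm_sub' (z s p x) (z s p x₀)
    linarith [hr s hs]
  have hδ : ∀ x, BddContOff S (fun s => fderiv ℝ (Φ s) (z s p x₀) (z s p x - z s p x₀)) p q :=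
    fun x => hA.clm_apply (((h.z_cont p hp x).sub (h.z_cont p hp x₀)).bddContOff S)
  refine exists_hasFDerivAt_of_eq_add_integral hS hp.2 (y := fun t => z t p)
    (A := fun s => fderiv ℝ (Φ s) (z s p x₀)) (m' := fun _ => 0) (b := fun x => x)
    (m := fun s x => Φ s (z s p x) - Φ s (z s p x₀)
      - fderiv ℝ (Φ s) (z s p x₀) (z s p x - z s p x₀)) (K := C * L + C * L)
    hA (continuousOn_const.bddContOff S) (hasFDerivAt_id x₀)
    (Eventually.of_forall fun x => ((hΦ.bddContOff_comp hp.1 (h.z_cont p hp x)).sub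
      (hΦ.bddContOff_comp hp.1 (h.z_cont p hp x₀))).sub (hδ x))
    ?_ ?_ (Eventually.of_forall fun x => h.z_cont p hp x) ?_
  · filter_upwards [hL] with x hx s hs
    obtain ⟨-, h2, h3⟩ := hC s (hsubS s hs) _ (hmem₀ s hs.1)
    have h4 := (hC s (hsubS s hs) _ (hmem x s hs.1 (hx s hs.1).2)).2.2 _ (hmem₀ s hs.1)
    have h5 : C * ‖z s p x - z s p x₀‖ ≤ C * (L * ‖x - x₀‖) :=
      mul_le_mul_of_nonneg_left (hx s hs.1).1 hC0
    have h6 := ContinuousLinearMap.le_of_opNorm_le _ h2 (z s p x - z s p x₀)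
    refine (norm_sub_le _ _).trans ?_
    linarith
  · intro s hs
    have hO : (fun x => z s p x - z s p x₀) =O[𝓝 x₀] fun x => x - x₀ :=
      Asymptotics.IsBigO.of_bound L (hL.mono fun x hx => (hx s hs.1).1)
    have hct : Tendsto (z s p) (𝓝 x₀) (𝓝 (z s p x₀)) := by
      have h0 : Tendsto (fun x => x - x₀) (𝓝 x₀) (𝓝 0) := by
        have : ContinuousAt (fun x => x - x₀) x₀ := by fun_prop
        simpa using this.tendsto
      simpa using (hO.trans_tendsto h0).add_const (z s p x₀)
    have hd := hasFDerivAt_iff_isLittleO.1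
      (hΦ.differentiable s (hsubS s hs).1 (z s p x₀)).hasFDerivAt
    rw [hasFDerivAt_iff_isLittleO]
    refine ((hd.comp_tendsto hct).trans_isBigO hO).congr_left fun x => ?_
    simp
  · refine Eventually.of_forall fun x t ht => ?_
    have i1 := (h.z_int p hp x).sub_Icc hpI ht
    have i2 := (h.z_int p hp x₀).sub_Icc hpI ht
    rw [h.z_eq p hp x t ht, h.z_eq p hp x₀ t ht]
    simp only [add_sub_cancel]
    rw [intervalIntegral.integral_sub i1 i2]
    abel

/-- The imbedded adjoint is differentiable in the state, for each initial time: along the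
trajectories, the multipliers solve a backward linear equation with differentiable data. -/
lemma IsAdjointFlow.differentiableAt_adjoint (h : IsAdjointFlow Φ G K z lam a q) (hS : S.Finite)
    (hΦ : RegularInState S Φ a q) (hK : RegularInState S K a q) (hG : RegularInState S G a q)
    (hH : Differentiable ℝ fun x => lam q q x) {p : ℝ} (hp : p ∈ Icc a q) (x₀ : E) :
    DifferentiableAt ℝ (fun x => lam p p x) x₀ := by
  obtain ⟨L, hL0, hL⟩ := h.exists_state_lipschitz hS hΦ hp x₀
  obtain ⟨V, hVc, hV⟩ := h.exists_hasFDerivAt_state hS hΦ hp x₀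
  obtain ⟨r, hr⟩ := isCompact_Icc.exists_bound_of_continuousOn (h.z_cont p hp x₀)
  obtain ⟨C₁, hC₁0, hC₁⟩ := hK.exists_bound_and_lipschitz 0 (r + 1)
  obtain ⟨C₂, hC₂0, hC₂⟩ := hG.exists_bound_and_lipschitz 0 (r + 1)
  have hpI : p ∈ Icc p q := ⟨le_rfl, hp.2⟩
  have hqI : q ∈ Icc p q := ⟨hp.2, le_rfl⟩
  have hsubS : ∀ s ∈ Icc p q \ S, s ∈ Icc a q \ S :=
    fun s hs => ⟨⟨hp.1.trans hs.1.1, hs.1.2⟩, hs.2⟩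
  have hmem₀ : ∀ s ∈ Icc p q, z s p x₀ ∈ Metric.closedBall 0 (r + 1) := fun s hs => by
    rw [mem_closedBall_zero_iff]
    linarith [hr s hs]
  have hmem : ∀ x, ∀ s ∈ Icc p q, ‖z s p x - z s p x₀‖ ≤ 1 →
      z s p x ∈ Metric.closedBall 0 (r + 1) := fun x s hs h1 => by
    rw [mem_closedBall_zero_iff]
    have := norm_le_norm_add_norm_sub' (z s p x) (z s p x₀)
    linarith [hr s hs]
  have bK : ∀ x, BddContOff S (fun s => K s (z s p x)) p q := fun x =>
    hK.bddContOff_comp hp.1 (h.z_cont p hp x)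
  have bG : ∀ x, BddContOff S (fun s => G s (z s p x)) p q := fun x =>
    hG.bddContOff_comp hp.1 (h.z_cont p hp x)
  have bl : ∀ x, BddContOff S (fun s => lam s p x) p q := fun x =>
    (h.lam_cont p hp x).bddContOff S
  set m : ℝ → E → E := fun s x => (K s (z s p x) - K s (z s p x₀)) (lam s p x)
    + (G s (z s p x) - G s (z s p x₀)) with hm
  have bm : ∀ x, BddContOff S (fun s => m s x) p q := fun x =>
    (((bK x).sub (bK x₀)).clm_apply (bl x)).add ((bG x).sub (bG x₀))
  have hlq : ∀ x, lam q p x = lam q q (z q p x) := fun x => h.lam_comp p hp x q hqI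
  have hterm : HasFDerivAt (fun x => lam q p x)
      ((fderiv ℝ (fun x => lam q q x) (z q p x₀)).comp (V q)) x₀ := by
    simp only [hlq]
    exact HasFDerivAt.comp x₀ (hH (z q p x₀)).hasFDerivAt (hV q hqI)
  -- the increments of the multipliers solve a linear equation with inhomogeneity `m`
  have heq : ∀ x, ∀ t ∈ Icc p q, lam t p x - lam t p x₀ = lam q p x - lam q p x₀ +
      ∫ s in t..q, (K s (z s p x₀) (lam s p x - lam s p x₀) + m s x) := by
    intro x t ht
    have i1 := (h.lam_int p hp x).sub_Icc ht hqI
    have i2 := (h.lam_int p hp x₀).sub_Icc ht hqI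
    rw [h.lam_eq p hp x t ht, h.lam_eq p hp x₀ t ht, add_sub_add_comm,
      ← intervalIntegral.integral_sub i1 i2]
    congr 1
    refine intervalIntegral.integral_congr fun s _ => ?_
    simp only [hm, map_sub, sub_apply]
    abel
  -- the multipliers are bounded near `x₀`
  obtain ⟨B, hB0, hB⟩ : ∃ B, 0 ≤ B ∧ ∀ᶠ x in 𝓝 x₀, ∀ t ∈ Icc p q, ‖lam t p x‖ ≤ B := by
    have hρ0 : 0 ≤ ∫ _ in p..q, C₂ := intervalIntegral.integral_nonneg hp.2 fun _ _ => hC₂0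
    refine ⟨(‖lam q p x₀‖ + 1 + ∫ _ in p..q, C₂) * Real.exp (C₁ * (q - p)), by positivity, ?_⟩
    filter_upwards [hL, hterm.continuousAt.tendsto.eventually_norm_le] with x hx hxq t ht
    refine (norm_le_of_eq_add_integral_right hS (u := fun t => lam t p x)
      (k := fun s => K s (z s p x) (lam s p x) + G s (z s p x)) (ρ := fun _ => C₂)
      (u₀ := lam q p x) (K := C₁) hp.2 hC₁0 (h.lam_cont p hp x) intervalIntegrable_const
      (fun _ => hC₂0) (h.lam_eq p hp x) (fun s hs => ?_) t ht).trans ?_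
    · have hz := hmem x s hs.1 (hx s hs.1).2
      exact (norm_add_le _ _).trans (add_le_add
        (ContinuousLinearMap.le_of_opNorm_le _ (hC₁ s (hsubS s hs) _ hz).1 _)
        (hC₂ s (hsubS s hs) _ hz).1)
    · gcongr
  have hmb : ∀ᶠ x in 𝓝 x₀, ∀ s ∈ Icc p q \ S,
      ‖m s x‖ ≤ (C₁ * L * B + C₂ * L) * ‖x - x₀‖ := by
    filter_upwards [hL, hB] with x hx hxB s hs
    have hz := hmem x s hs.1 (hx s hs.1).2
    have h1 := (hC₁ s (hsubS s hs) _ hz).2.2 _ (hmem₀ s hs.1)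
    have h2 := (hC₂ s (hsubS s hs) _ hz).2.2 _ (hmem₀ s hs.1)
    have h3 := (hx s hs.1).1
    calc ‖m s x‖ ≤ C₁ * (L * ‖x - x₀‖) * B + C₂ * (L * ‖x - x₀‖) :=
          (norm_add_le _ _).trans (add_le_add
            (ContinuousLinearMap.le_of_opNorm_le_of_le _
              (h1.trans (mul_le_mul_of_nonneg_left h3 hC₁0)) (hxB s hs.1))
            (h2.trans (mul_le_mul_of_nonneg_left h3 hC₂0)))
      _ = _ := by ring
  -- the multipliers are continuous in the state
  have hlc : ∀ t ∈ Icc p q, ContinuousAt (fun x => lam t p x) x₀ := by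
    intro t ht
    set M := C₁ * L * B + C₂ * L with hM
    have hM0 : 0 ≤ M := by positivity
    have hlim : Tendsto (fun x => (‖lam q p x - lam q p x₀‖ + ∫ _ in p..q, M * ‖x - x₀‖)
        * Real.exp (C₁ * (q - p))) (𝓝 x₀) (𝓝 0) := by
      have : ContinuousAt (fun x => (‖lam q p x - lam q p x₀‖ + ∫ _ in p..q, M * ‖x - x₀‖)
        * Real.exp (C₁ * (q - p))) x₀ := by
        simp only [intervalIntegral.integral_const]
        have := hterm.continuousAt
        fun_prop
      simpa using this.tendsto
    rw [ContinuousAt, tendsto_iff_norm_sub_tendsto_zero]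
    refine squeeze_zero' (Eventually.of_forall fun x => norm_nonneg _) ?_ hlim
    filter_upwards [hmb] with x hx
    refine norm_le_of_eq_add_integral_right hS (u := fun t => lam t p x - lam t p x₀)
      (k := fun s => K s (z s p x₀) (lam s p x - lam s p x₀) + m s x)
      (ρ := fun _ => M * ‖x - x₀‖) hp.2 hC₁0
      ((h.lam_cont p hp x).sub (h.lam_cont p hp x₀)) intervalIntegrable_const
      (fun _ => by positivity) (heq x) (fun s hs => ?_) t ht
    exact (norm_add_le _ _).trans (add_le_add
      (ContinuousLinearMap.le_of_opNorm_le _ (hC₁ s (hsubS s hs) _ (hmem₀ s hs.1)).1 _) (hx s hs))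
  have bm' : BddContOff S (fun s => ((fderiv ℝ (K s) (z s p x₀)).comp (V s)).flip (lam s p x₀)
      + (fderiv ℝ (G s) (z s p x₀)).comp (V s)) p q := by
    have b1 := (hK.bddContOff_fderiv_comp hp.1 (h.z_cont p hp x₀)).clm_comp (hVc.bddContOff S)
    have b2 := (hG.bddContOff_fderiv_comp hp.1 (h.z_cont p hp x₀)).clm_comp (hVc.bddContOff S)
    exact (b1.clm_flip_apply (bl x₀)).add b2
  have hmd : ∀ s ∈ Icc p q \ S, HasFDerivAt (m s)
      (((fderiv ℝ (K s) (z s p x₀)).comp (V s)).flip (lam s p x₀)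
        + (fderiv ℝ (G s) (z s p x₀)).comp (V s)) x₀ := by
    intro s hs
    have hsa := (hsubS s hs).1
    have hκ : HasFDerivAt (fun x => K s (z s p x) - K s (z s p x₀))
        ((fderiv ℝ (K s) (z s p x₀)).comp (V s)) x₀ :=
      (HasFDerivAt.comp x₀ (hK.differentiable s hsa (z s p x₀)).hasFDerivAt
        (hV s hs.1)).sub_const _
    have hγ : HasFDerivAt (fun x => G s (z s p x) - G s (z s p x₀))
        ((fderiv ℝ (G s) (z s p x₀)).comp (V s)) x₀ :=
      (HasFDerivAt.comp x₀ (hG.differentiable s hsa (z s p x₀)).hasFDerivAt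
        (hV s hs.1)).sub_const _
    exact (hκ.clm_apply_of_eq_zero (sub_self _) (hlc s hs.1)).add hγ
  obtain ⟨w, -, hw⟩ := exists_hasFDerivAt_of_eq_add_integral_right hS hp.2
    (y := fun t x => lam t p x) (A := fun s => K s (z s p x₀)) (bK x₀) bm' hterm
    (Eventually.of_forall bm) hmb hmd (Eventually.of_forall fun x => h.lam_cont p hp x)
    (Eventually.of_forall heq)
  exact (hw p hpI).differentiableAt

end StateDerivative

/-! ### The imbedded adjoint equation -/

section Feedback

variable {E P Y : Type*} [NormedAddCommGroup E] [NormedAddCommGroup P] [TopologicalSpace Y]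

lemma ContinuousOn.continuousWithinAt_feedback {F : ℝ → E → P → Y} {Ψ : ℝ → E → P} {a q p : ℝ}
    {x : E} (hF : ContinuousOn (fun w : ℝ × E × P => F w.1 w.2.1 w.2.2) (Icc a q ×ˢ univ))
    (hp : p ∈ Icc a q)
    (hΨ : ContinuousWithinAt (Function.uncurry Ψ) (Icc a q ×ˢ univ) (p, x)) :
    ContinuousWithinAt (Function.uncurry fun t y => F t y (Ψ t y)) (Icc a q ×ˢ univ) (p, x) := by
  refine ContinuousWithinAt.comp (t := Icc a q ×ˢ univ) (x := (p, x))
    (g := fun w : ℝ × E × P => F w.1 w.2.1 w.2.2) (f := fun w => (w.1, w.2, Ψ w.1 w.2))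
    (hF _ ⟨hp, mem_univ _⟩) ?_ fun w hw => ⟨hw.1, mem_univ _⟩
  exact continuousWithinAt_fst.prodMk (continuousWithinAt_snd.prodMk hΨ)

end Feedback

/-- Transposition, as a real linear map of operators. -/
noncomputable def adjointCLM (E : Type*) [NormedAddCommGroup E] [InnerProductSpace ℝ E]
    [CompleteSpace E] : (E →L[ℝ] E) →L[ℝ] (E →L[ℝ] E) where
  toFun := fun A => ContinuousLinearMap.adjoint A
  map_add' := map_add _
  map_smul' := fun c A => by simp
  cont := ContinuousLinearMap.adjoint.continuous

open InvariantImbedding in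
theorem theorem2 {N M : ℕ} {a q : ℝ} (haq : a < q)
    (f : ℝ → EuclideanSpace ℝ (Fin N) → EuclideanSpace ℝ (Fin M) → EuclideanSpace ℝ (Fin N))
    (R : ℝ → EuclideanSpace ℝ (Fin N) → EuclideanSpace ℝ (Fin M) → ℝ)
    (T : EuclideanSpace ℝ (Fin N) → ℝ)
    -- the families `θ(t; p, x)`, `z(t; p, x)`, `λ(t; p, x)`
    (θ : ℝ → ℝ → EuclideanSpace ℝ (Fin N) → EuclideanSpace ℝ (Fin M))
    (z lam : ℝ → ℝ → EuclideanSpace ℝ (Fin N) → EuclideanSpace ℝ (Fin N))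
    -- `f` is continuous, and continuously differentiable in `z`
    (hf : ContinuousOn (fun w : ℝ × EuclideanSpace ℝ (Fin N) × EuclideanSpace ℝ (Fin M) =>
      f w.1 w.2.1 w.2.2) (Icc a q ×ˢ univ))
    (hfz : ∀ t ∈ Icc a q, ∀ u, Differentiable ℝ (fun y => f t y u))
    (hfz' : ContinuousOn (fun w : ℝ × EuclideanSpace ℝ (Fin N) × EuclideanSpace ℝ (Fin M) =>
      zJac f w.1 w.2.1 w.2.2) (Icc a q ×ˢ univ))
    -- the running loss is continuously differentiable in `z`, the terminal loss differentiable
    (hRz : ∀ t ∈ Icc a q, ∀ u, Differentiable ℝ (fun y => R t y u))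
    (hRz' : ContinuousOn (fun w : ℝ × EuclideanSpace ℝ (Fin N) × EuclideanSpace ℝ (Fin M) =>
      zGrad R w.1 w.2.1 w.2.2) (Icc a q ×ˢ univ))
    (hT : Differentiable ℝ T)
    -- admissible controls, the trajectories they generate, the multipliers
    (hθ : ∀ p ∈ Icc a q, ∀ x, PiecewiseContinuousOn (fun t => θ t p x) p q)
    (hz : ∀ p ∈ Icc a q, ∀ x,
      IsTrajectory f (fun t => θ t p x) (fun t => z t p x) p q x)
    (hlam : ∀ p ∈ Icc a q, ∀ x,
      IsLagrangeMultiplier f R T (fun t => θ t p x) (fun t => z t p x) (fun t => lam t p x) p q)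
    -- invariant imbedding of the controls; automatic if `θ` is a function of `t` alone
    (himb : ∀ p s t : ℝ, a ≤ p → p ≤ s → s ≤ t → t ≤ q → ∀ x,
      θ t p x = θ t s (z s p x)) :
    -- initial value at `p = q`
    (∀ x, imbed lam q x = gradient T x) ∧
    -- the differential equation
    (∀ p ∈ Icc a q, ∀ x,
      ContinuousWithinAt (Function.uncurry (imbed θ)) (Icc a q ×ˢ univ) (p, x) →
      DifferentiableWithinAt ℝ (Function.uncurry (imbed lam)) (Icc a q ×ˢ univ) (p, x) →
      -derivWithin (fun s => imbed lam s x) (Icc a q) p =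
        fderiv ℝ (imbed lam p) x (imbedDyn f θ p x)
        + ContinuousLinearMap.adjoint (zJac f p x (imbed θ p x)) (imbed lam p x)
        + zGrad R p x (imbed θ p x)) ∧
    -- if the coefficients and the initial value are continuously differentiable in `x`,
    -- then the imbedded adjoint is differentiable, so that the equation holds
    (C1InState (imbedDyn f θ) a q →
      C1InState (fun p x => zJac f p x (imbed θ p x)) a q →
      C1InState (fun p x => zGrad R p x (imbed θ p x)) a q →
      ContDiff ℝ 1 (gradient T) →
      ∀ p ∈ Icc a q, ∀ x,
        ContinuousWithinAt (Function.uncurry (imbed θ)) (Icc a q ×ˢ univ) (p, x) →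
        DifferentiableWithinAt ℝ (Function.uncurry (imbed lam)) (Icc a q ×ˢ univ) (p, x)) := by
  have hflow := isAdjointFlow_of_imbedding hf hfz hfz' hRz' hθ hz hlam himb
  have hterm : ∀ x, imbed lam q x = gradient T x := fun x => by
    have hq : q ∈ Icc a q := ⟨haq.le, le_rfl⟩
    have h1 := (hlam q hq x).terminal
    rwa [(hz q hq x).initial] at h1
  have cΦ : ∀ p ∈ Icc a q, ∀ x,
      ContinuousWithinAt (Function.uncurry (imbed θ)) (Icc a q ×ˢ univ) (p, x) →
      ContinuousWithinAt (Function.uncurry (imbedDyn f θ)) (Icc a q ×ˢ univ) (p, x) :=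
    fun p hp x hΨ => hf.continuousWithinAt_feedback hp hΨ
  have cG : ∀ p ∈ Icc a q, ∀ x,
      ContinuousWithinAt (Function.uncurry (imbed θ)) (Icc a q ×ˢ univ) (p, x) →
      ContinuousWithinAt (Function.uncurry fun p x => zGrad R p x (imbed θ p x))
        (Icc a q ×ˢ univ) (p, x) :=
    fun p hp x hΨ => hRz'.continuousWithinAt_feedback hp hΨ
  have cK : ∀ p ∈ Icc a q, ∀ x,
      ContinuousWithinAt (Function.uncurry (imbed θ)) (Icc a q ×ˢ univ) (p, x) →
      ContinuousWithinAt (Function.uncurry fun p x =>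
        ContinuousLinearMap.adjoint (zJac f p x (imbed θ p x))) (Icc a q ×ˢ univ) (p, x) :=
    fun p hp x hΨ => (adjointCLM _).continuous.continuousAt.comp_continuousWithinAt
      (hfz'.continuousWithinAt_feedback hp hΨ)
  refine ⟨hterm, fun p hp x hΨ hΛ => ?_, fun hΦ hJ hG hT' p hp x hΨ => ?_⟩
  · have hL := hΛ.hasFDerivWithinAt
    set L := fderivWithin ℝ (Function.uncurry (imbed lam)) (Icc a q ×ˢ univ) (p, x)
    have hmain : L (1, imbedDyn f θ p x) =
        -(ContinuousLinearMap.adjoint (zJac f p x (imbed θ p x)) (imbed lam p x)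
          + zGrad R p x (imbed θ p x)) :=
      hflow.fderivWithin_apply haq hp (cΦ p hp x hΨ) (cK p hp x hΨ) (cG p hp x hΨ) hL
    have htime : derivWithin (fun s => imbed lam s x) (Icc a q) p = L (1, 0) := by
      refine HasDerivWithinAt.derivWithin ?_ (uniqueDiffOn_Icc haq p hp)
      exact hL.comp_hasDerivWithinAt (f := fun s => (s, x)) p
        ((hasDerivWithinAt_id p _).prodMk (hasDerivWithinAt_const p _ x))
        fun s hs => ⟨hs, mem_univ _⟩
    have hstate : fderiv ℝ (imbed lam p) x (imbedDyn f θ p x) = L (0, imbedDyn f θ p x) := by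
      have h1 : HasFDerivAt (imbed lam p)
          (L.comp (ContinuousLinearMap.inr ℝ ℝ (EuclideanSpace ℝ (Fin N)))) x := by
        rw [← hasFDerivWithinAt_univ]
        exact hL.comp (f := fun y => (p, y)) x
          (hasFDerivAt_prodMk_right p x).hasFDerivWithinAt fun y _ => ⟨hp, mem_univ _⟩
      rw [h1.fderiv]
      simp
    have hsplit : L (1, imbedDyn f θ p x) = L (1, 0) + L (0, imbedDyn f θ p x) := by
      rw [← map_add]
      simp
    rw [htime, hstate, add_assoc, ← neg_eq_iff_eq_neg.2 hmain, hsplit]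
    abel
  · obtain ⟨S₁, hS₁, r₁⟩ := hΦ.exists_regularInState
    obtain ⟨S₂, hS₂, r₂⟩ := hJ.exists_regularInState
    obtain ⟨S₃, hS₃, r₃⟩ := hG.exists_regularInState
    have hS : (S₁ ∪ S₂ ∪ S₃).Finite := (hS₁.union hS₂).union hS₃
    replace r₁ := r₁.mono (S' := S₁ ∪ S₂ ∪ S₃) fun t ht => Or.inl (Or.inl ht)
    replace r₂ := (r₂.clm_comp (adjointCLM _)).mono (S' := S₁ ∪ S₂ ∪ S₃)
      fun t ht => Or.inl (Or.inr ht)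
    replace r₃ := r₃.mono (S' := S₁ ∪ S₂ ∪ S₃) fun t ht => Or.inr ht
    have hH : Differentiable ℝ fun x => lam q q x := by
      have h1 : (fun x => lam q q x) = gradient T := funext hterm
      rw [h1]
      exact hT'.differentiable one_ne_zero
    obtain ⟨C, -, hC⟩ := r₁.exists_bound_and_lipschitz x 1
    exact hflow.differentiableWithinAt hp (cΦ p hp x hΨ) (cK p hp x hΨ) (cG p hp x hΨ) hS one_pos
      (fun t ht y hy y' hy' => (hC t ht y hy).2.2 y' hy')
      (hflow.differentiableAt_adjoint hS r₁ r₂ r₃ hH hp x)
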